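/- **Theorem 3.** The model is the word RAM with $w$-bit words: constantly many registers, a read-only input memory, a read-write working memory with arbitrary initial contents, and a write-only output; each instruction (arithmetic and bitwise operations modulo $2^w$, memory access, comparison, output) takes one time unit. A graph with vertex set $\{0,\dots,n-1\}$ is given as a plain adjacency array in the input memory: an array of length $n$ whose $v$-th entry is a pointer to an array that stores the length of the list of (out-)neighbours of $v$, followed by these neighbours, each once, in some order. There are no cross pointers, and the placement of the arrays is arbitrary. The program is given $n$ and $w$ in registers. There are a single word RAM program and constants $k, C$ (independent of the graph, of its representation and of $w$) such that for every directed graph (self-loops allowed) and every simple undirected graph with $n\ge 1$ vertices and $m$ edges, given as an adjacency array, and for every word size $w \ge \lceil\log_2(n+m+1)\rceil + k$, the program performs a depth-first search traversal of the whole graph in at most $C(n+m)$ time steps, using at most $C(n+m+w)$ bits for its registers and its working memory together; that is, it runs in $O(m+n)$ time with $O(m+n)$ bits of working space besides $O(1)$ machine words, hence with $O(m+n)$ bits in all as long as $w = O(m+n)$. Here, performing the traversal means writing to the output, in order, the events "discover $v$" and "finish $v$" of the recursive depth-first search that tries $0,1,\dots,n-1$ in this order as roots and scans the neighbours of every vertex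 in the order of its array. -/

import Mathlib

/-! ## Depth-first search -/

/-- `adj u` lists the (out-)neighbours of `u` with respect to the adjacency relation `Adj`,
each exactly once, in an arbitrary order. -/
def ListsNeighbors {n : ℕ} (Adj : Fin n → Fin n → Prop) (adj : Fin n → List (Fin n)) : Prop :=
  ∀ u, (adj u).Nodup ∧ ∀ v, v ∈ adj u ↔ Adj u v

/-- The events of a depth-first traversal: discovering a vertex, and finishing it (backtracking
out of it after its whole neighbour list has been scanned). -/
inductive DFSEvent (V : Type) where
  | enter (v : V)
  | exit (v : V)

/-- `DFSScan adj vs S es S'`: scanning the vertices `vs` from left to right, recursively visiting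
each one that is still undiscovered when its turn comes, and starting with the set `S` of
discovered vertices, produces the events `es` and ends with the set `S'` of discovered vertices. -/
inductive DFSScan {V : Type} [DecidableEq V] (adj : V → List V) :
    List V → Finset V → List (DFSEvent V) → Finset V → Prop where
  | nil (S : Finset V) : DFSScan adj [] S [] S
  | skip {v : V} {vs : List V} {S S' : Finset V} {es : List (DFSEvent V)} :
      v ∈ S → DFSScan adj vs S es S' → DFSScan adj (v :: vs) S es S'
  | visit {v : V} {vs : List V} {S S₁ S₂ : Finset V} {es₁ es₂ : List (DFSEvent V)} :
      v ∉ S → DFSScan adj (adj v) (insert v S) es₁ S₁ → DFSScan adj vs S₁ es₂ S₂ →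
      DFSScan adj (v :: vs) S (DFSEvent.enter v :: es₁ ++ DFSEvent.exit v :: es₂) S₂

/-- `es` is the event sequence of the depth-first traversal of the whole graph: the vertices
`0, …, n - 1` are tried as roots in this order, neighbours in the order of the lists `adj`. -/
def IsDFSTraversal {n : ℕ} (adj : Fin n → List (Fin n)) (es : List (DFSEvent (Fin n))) : Prop :=
  ∃ S, DFSScan adj (List.finRange n) ∅ es S

/-- Each event is reported as two output words: a tag and the index of the vertex. -/
def DFSEvent.encode {n : ℕ} : DFSEvent (Fin n) → List ℕ
  | .enter v => [0, v]
  | .exit v => [1, v]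

/-! ## The word RAM

Words are natural numbers below `2 ^ w`. A program has finitely many registers, a read-only input
memory, a read-write working memory and a write-only output stream. Every elementary instruction
and every evaluation of a test takes one time unit. Programs are written with structured control
flow, i.e. conditional jumps are used only in the form of `if` and `while`. -/

namespace WordRAM

/-- The arithmetic and bitwise operations on words. -/
inductive Op where
  | add | sub | mul | div | mod | and | or | xor | shl | shr

/-- All results are reduced modulo `2 ^ w`. -/
def Op.eval (w : ℕ) : Op → ℕ → ℕ → ℕ
  | .add, x, y => (x + y) % 2 ^ w
  | .sub, x, y => (x + (2 ^ w - y)) % 2 ^ w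
  | .mul, x, y => (x * y) % 2 ^ w
  | .div, x, y => (x / y) % 2 ^ w
  | .mod, x, y => (x % y) % 2 ^ w
  | .and, x, y => (x &&& y) % 2 ^ w
  | .or, x, y => (x ||| y) % 2 ^ w
  | .xor, x, y => (x ^^^ y) % 2 ^ w
  | .shl, x, y => (x <<< y) % 2 ^ w
  | .shr, x, y => (x >>> y) % 2 ^ w

/-- Elementary instructions; `d`, `a`, `b`, `s` are register indices. -/
inductive Instr where
  /-- put the constant `k` into register `d` -/
  | const (d k : ℕ)
  /-- copy register `a` to register `d` -/
  | move (d a : ℕ)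
  /-- apply `o` to registers `a` and `b`, result into register `d` -/
  | op (o : Op) (d a b : ℕ)
  /-- read into `d` the input cell whose address is in `a` -/
  | readInput (d a : ℕ)
  /-- read into `d` the working cell whose address is in `a` -/
  | load (d a : ℕ)
  /-- write register `s` to the working cell whose address is in `a` -/
  | store (a s : ℕ)
  /-- append register `s` to the output -/
  | output (s : ℕ)

/-- Comparisons of two registers. -/
inductive Test where
  | lt (a b : ℕ)
  | le (a b : ℕ)
  | eq (a b : ℕ)
  | ne (a b : ℕ)

/-- Word RAM programs. -/
inductive Program where
  | skip
  | instr (i : Instr)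
  | seq (P Q : Program)
  | ite (b : Test) (P Q : Program)
  | loop (b : Test) (P : Program)

/-- Configurations. `time` counts the steps made so far, and `cells` is the least number such that
only working cells with addresses below `cells` have been accessed so far. -/
structure State where
  reg : ℕ → ℕ
  work : ℕ → ℕ
  out : List ℕ
  time : ℕ
  cells : ℕ

def State.setReg (σ : State) (d x : ℕ) : State :=
  { σ with reg := Function.update σ.reg d x }

/-- Charge one time unit. -/
def State.tick (σ : State) : State :=
  { σ with time := σ.time + 1 }

/-- Record an access to working cell `a`. -/
def State.touch (σ : State) (a : ℕ) : State :=
  { σ with cells := max σ.cells (a + 1) }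

/-- Effect of an instruction, for word size `w` and input memory `inp`. -/
def Instr.exec (w : ℕ) (inp : ℕ → ℕ) : Instr → State → State
  | .const d k, σ => (σ.setReg d (k % 2 ^ w)).tick
  | .move d a, σ => (σ.setReg d (σ.reg a)).tick
  | .op o d a b, σ => (σ.setReg d (o.eval w (σ.reg a) (σ.reg b))).tick
  | .readInput d a, σ => (σ.setReg d (inp (σ.reg a))).tick
  | .load d a, σ => ((σ.setReg d (σ.work (σ.reg a))).touch (σ.reg a)).tick
  | .store a s, σ =>
      (({ σ with work := Function.update σ.work (σ.reg a) (σ.reg s) }).touch (σ.reg a)).tick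
  | .output s, σ => ({ σ with out := σ.out ++ [σ.reg s] }).tick

def Test.Holds (σ : State) : Test → Prop
  | .lt a b => σ.reg a < σ.reg b
  | .le a b => σ.reg a ≤ σ.reg b
  | .eq a b => σ.reg a = σ.reg b
  | .ne a b => σ.reg a ≠ σ.reg b

/-- `P.Runs w inp σ τ`: started in `σ`, the program `P` terminates, in configuration `τ`. -/
inductive Program.Runs (w : ℕ) (inp : ℕ → ℕ) : Program → State → State → Prop where
  | skip (σ : State) : Program.Runs w inp .skip σ σ
  | instr (i : Instr) (σ : State) : Program.Runs w inp (.instr i) σ (i.exec w inp σ)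
  | seq {P Q : Program} {σ τ υ : State} :
      Program.Runs w inp P σ τ → Program.Runs w inp Q τ υ → Program.Runs w inp (.seq P Q) σ υ
  | ite_true {b : Test} {P Q : Program} {σ τ : State} :
      b.Holds σ → Program.Runs w inp P σ.tick τ → Program.Runs w inp (.ite b P Q) σ τ
  | ite_false {b : Test} {P Q : Program} {σ τ : State} :
      ¬ b.Holds σ → Program.Runs w inp Q σ.tick τ → Program.Runs w inp (.ite b P Q) σ τ
  | loop_true {b : Test} {P : Program} {σ τ υ : State} :
      b.Holds σ → Program.Runs w inp P σ.tick τ → Program.Runs w inp (.loop b P) τ υ →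
      Program.Runs w inp (.loop b P) σ υ
  | loop_false {b : Test} {P : Program} {σ : State} :
      ¬ b.Holds σ → Program.Runs w inp (.loop b P) σ σ.tick

/-- A number exceeding all register indices that occur in the instruction. -/
def Instr.regs : Instr → ℕ
  | .const d _ => d + 1
  | .move d a => max d a + 1
  | .op _ d a b => max d (max a b) + 1
  | .readInput d a => max d a + 1
  | .load d a => max d a + 1
  | .store a s => max a s + 1
  | .output s => s + 1

def Test.regs : Test → ℕ
  | .lt a b => max a b + 1
  | .le a b => max a b + 1
  | .eq a b => max a b + 1
  | .ne a b => max a b + 1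

/-- The number of registers of a program. -/
def Program.regs : Program → ℕ
  | .skip => 0
  | .instr i => i.regs
  | .seq P Q => max P.regs Q.regs
  | .ite b P Q => max b.regs (max P.regs Q.regs)
  | .loop b P => max b.regs P.regs

/-- Initially register `0` holds the number `n` of vertices, register `1` holds the word size, all
other registers hold `0`, and the working memory has the (arbitrary) contents `work`. -/
def initial (n w : ℕ) (work : ℕ → ℕ) : State where
  reg i := if i = 0 then n else if i = 1 then w else 0
  work := work
  out := []
  time := 0
  cells := 0

/-- The input memory holds the plain adjacency array with neighbour lists `adj`: an array of length
`n` at address `0`, whose `v`-th entry is a pointer to an array that stores the neighbours of `v`,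
preceded by its length. Nothing is assumed about the placement of these arrays. -/
structure IsAdjacencyArray {n : ℕ} (w : ℕ) (adj : Fin n → List (Fin n)) (inp : ℕ → ℕ) : Prop where
  word : ∀ a, inp a < 2 ^ w
  fits : ∀ v : Fin n, inp v + (adj v).length < 2 ^ w
  length : ∀ v : Fin n, inp (inp v) = (adj v).length
  neighbor : ∀ (v : Fin n) (j : ℕ) (hj : j < (adj v).length), inp (inp v + 1 + j) = (adj v)[j]

/-- On every adjacency array with neighbour lists `adj`, with words of `w` bits and whatever the
working memory contains at the start, `P` terminates after at most `T` steps, has then written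
the depth-first traversal to the output, and has used at most `B` bits for its registers and
working memory together. -/
def PerformsDFS (P : Program) {n : ℕ} (adj : Fin n → List (Fin n)) (w T B : ℕ) : Prop :=
  ∀ inp work : ℕ → ℕ, IsAdjacencyArray w adj inp → (∀ a, work a < 2 ^ w) →
    ∃ (τ : State) (es : List (DFSEvent (Fin n))),
      P.Runs w inp (initial n w work) τ ∧
      IsDFSTraversal adj es ∧ τ.out = es.flatMap DFSEvent.encode ∧
      τ.time ≤ T ∧ w * (P.regs + τ.cells) ≤ B

end WordRAM

/-! The obstacle is the stack: storing a vertex and a position for each ancestor takes `Θ(n log n)`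
bits in the worst case. Let `D` be the sum of all degrees and `ℓ` the bit length of `n + D`. For an
ancestor `u`, the stack keeps only the index, in the list of `u`, of the next vertex on the current
path, in a field of `min (deg u) ℓ` bits. Ancestors are distinct, so all the fields together take at
most `D` bits.

The vertices themselves can be recovered: a vertex fixes the width of its field, and vertex and
index together fix the next vertex. This decodes the path only in the direction away from the root,
whereas backtracking needs the parent. Two devices help. At every level divisible by `ℓ` a
checkpoint records the vertex and the offset of its field; these records of `2ℓ` bits, one per `ℓ`
levels, occupy `2n + 2ℓ` bits. A circular buffer holds the vertices of at most `ℓ` topmost levels of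
the stack, in `ℓ²` bits, which is `O(n + D)` because `2 ^ ℓ ≤ 2 (n + D)`. When backtracking finds
the buffer empty, the path is replayed from the last checkpoint below the current depth, which
refills it.

A replay takes time proportional to the number of levels restored. It is paid for by `potential`,
which adds to the time a fixed amount per free place of the buffer: a descent does not increase the
number of free places, backtracking increases it by one, and a replay decreases it by the number of
restored levels. So each search step has constant amortized cost, and there are `O(n + D)` steps:
one per list entry and one per finished vertex.

The algorithm is written and verified in a small language `Cmd` with bit-addressed memory and a
weakest-precondition calculus that tracks time; `Cmd.code_runs` transfers the results to the word
RAM. The single commands are treated in `wp_descend`, `wp_restore` and `wp_ascend`.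
`searchLoop_scan` and `rootLoop_scan` follow a derivation of `DFSScan`, which exists by
`DFSScan.exists`, and `performsDFS` collects the bounds. -/

namespace WordRAM

/-! ## Bit fields of a bit-addressed memory -/

/-- The number whose binary digits are the `f` bits at address `p`, least significant first. -/
def readBits (M : ℕ → Bool) (p f : ℕ) : ℕ :=
  Nat.ofBits fun i : Fin f => M (p + i)

/-- Replace the `f` bits at address `p` by the binary digits of `x`. -/
def writeBits (M : ℕ → Bool) (p f x : ℕ) : ℕ → Bool :=
  fun q => if p ≤ q ∧ q < p + f then x.testBit (q - p) else M q

theorem testBit_readBits (M : ℕ → Bool) (p f i : ℕ) :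
    (readBits M p f).testBit i = (decide (i < f) && M (p + i)) := by
  unfold readBits
  rw [Nat.testBit_ofBits]
  by_cases h : i < f <;> simp [h]

theorem readBits_lt (M : ℕ → Bool) (p f : ℕ) : readBits M p f < 2 ^ f :=
  Nat.ofBits_lt_two_pow _

theorem readBits_writeBits_self {M : ℕ → Bool} {p f x : ℕ} (hx : x < 2 ^ f) :
    readBits (writeBits M p f x) p f = x := by
  apply Nat.eq_of_testBit_eq
  intro i
  rw [testBit_readBits]
  by_cases h : i < f
  · simp [h, writeBits]
  · simp only [h, decide_false, Bool.false_and]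
    exact (Nat.testBit_eq_false_of_lt
      (hx.trans_le (Nat.pow_le_pow_right (by norm_num) (by omega)))).symm

theorem readBits_congr {M N : ℕ → Bool} {p f : ℕ} (h : ∀ i < f, M (p + i) = N (p + i)) :
    readBits M p f = readBits N p f := by
  unfold readBits
  congr 1
  funext i
  exact h i i.2

theorem writeBits_of_outside {M : ℕ → Bool} {p f x q : ℕ} (h : q < p ∨ p + f ≤ q) :
    writeBits M p f x q = M q := by
  unfold writeBits
  rw [if_neg (by omega)]

theorem readBits_writeBits_of_disjoint {M : ℕ → Bool} {p f x q g : ℕ}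
    (h : q + g ≤ p ∨ p + f ≤ q) : readBits (writeBits M p f x) q g = readBits M q g :=
  readBits_congr fun _ _ => writeBits_of_outside (by omega)

theorem readBits_one (M : ℕ → Bool) (p : ℕ) : readBits M p 1 = (M p).toNat := by
  simp [readBits, Nat.ofBits_succ]

/-! ## A language of commands over a bit-addressed memory -/

/-- Program variables. -/
inductive Var where
  | num | ell | ck | js | cur | pos | dep | lo | top | flag | root | zero | total | pw | deg | nbr
  | col | lvl | off | len

/-- The register that holds a variable. -/
def Var.idx : Var → ℕ
  | num => 0 | ell => 2 | ck => 3 | js => 4 | cur => 5 | pos => 6 | dep => 7 | lo => 8 | top => 9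
  | flag => 10 | root => 11 | zero => 12 | total => 13 | pw => 14 | deg => 15 | nbr => 16
  | col => 17 | lvl => 18 | off => 19 | len => 20

/-- Registers from `40` on are thus free for evaluating expressions and accessing fields; register
`1` is avoided because it keeps the word size. -/
theorem Var.idx_lt (a : Var) : a.idx < 40 := by cases a <;> simp [Var.idx]

theorem Var.idx_ne_one (a : Var) : a.idx ≠ 1 := by cases a <;> simp [Var.idx]

theorem Var.idx_inj {a b : Var} : a.idx = b.idx ↔ a = b := by
  cases a <;> cases b <;> simp [Var.idx]

instance : DecidableEq Var := fun _ _ => decidable_of_iff _ Var.idx_inj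

inductive Arith where
  | add | sub | mul | mod

def Arith.toOp : Arith → Op
  | add => .add | sub => .sub | mul => .mul | mod => .mod

/-- The value over the natural numbers. -/
def Arith.val : Arith → ℕ → ℕ → ℕ
  | add, x, y => x + y
  | sub, x, y => x - y
  | mul, x, y => x * y
  | mod, x, y => x % y

/-- The result over the natural numbers is that over words. -/
def Arith.Fits (w : ℕ) : Arith → ℕ → ℕ → Prop
  | add, x, y => x + y < 2 ^ w
  | sub, x, y => y ≤ x
  | mul, x, y => x * y < 2 ^ w
  | mod, _, _ => True

theorem Arith.eval_toOp {w x y : ℕ} (o : Arith) (hx : x < 2 ^ w) (h : o.Fits w x y) :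
    o.toOp.eval w x y = o.val x y := by
  cases o <;> simp only [toOp, Op.eval, val, Fits] at *
  · exact Nat.mod_eq_of_lt h
  · have : x + (2 ^ w - y) = x - y + 2 ^ w ∨ 2 ^ w < y := by omega
    rcases this with h' | h'
    · rw [h', Nat.add_mod_right, Nat.mod_eq_of_lt (by omega)]
    · omega
  · exact Nat.mod_eq_of_lt h
  · exact Nat.mod_eq_of_lt ((Nat.mod_le _ _).trans_lt hx)

inductive Expr where
  | const (k : ℕ)
  | var (a : Var)
  | arith (o : Arith) (a b : Expr)
  | input (a : Expr)

def Expr.val (inp : ℕ → ℕ) (ρ : Var → ℕ) : Expr → ℕ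
  | const k => k
  | var a => ρ a
  | arith o a b => o.val (a.val inp ρ) (b.val inp ρ)
  | input a => inp (a.val inp ρ)

/-- The side condition under which no intermediate result wraps around, so that the algorithm can be
analysed over the natural numbers. Nothing is asked of the value read from the input, since input
cells hold words. -/
def Expr.Fits (w : ℕ) (inp : ℕ → ℕ) (ρ : Var → ℕ) : Expr → Prop
  | const k => k < 2 ^ w
  | var _ => True
  | arith o a b =>
      a.Fits w inp ρ ∧ b.Fits w inp ρ ∧ o.Fits w (a.val inp ρ) (b.val inp ρ)
  | input a => a.Fits w inp ρ

def Expr.cost : Expr → ℕ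
  | const _ => 1
  | var _ => 1
  | arith _ a b => a.cost + b.cost + 1
  | input a => a.cost + 1

instance (k : ℕ) : OfNat Expr k := ⟨.const k⟩
instance : Add Expr := ⟨.arith .add⟩
instance : Sub Expr := ⟨.arith .sub⟩
instance : Mul Expr := ⟨.arith .mul⟩
instance : Mod Expr := ⟨.arith .mod⟩

section
variable (w : ℕ) (inp : ℕ → ℕ) (ρ : Var → ℕ) (a b : Expr) (k : ℕ)

theorem Expr.val_ofNat : (no_index (OfNat.ofNat k) : Expr).val inp ρ = k := rfl
theorem Expr.val_add : (a + b).val inp ρ = a.val inp ρ + b.val inp ρ := rfl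
theorem Expr.val_sub : (a - b).val inp ρ = a.val inp ρ - b.val inp ρ := rfl
theorem Expr.val_mul : (a * b).val inp ρ = a.val inp ρ * b.val inp ρ := rfl
theorem Expr.val_mod : (a % b).val inp ρ = a.val inp ρ % b.val inp ρ := rfl
theorem Expr.val_var (a : Var) : (Expr.var a).val inp ρ = ρ a := rfl
theorem Expr.val_input : (Expr.input a).val inp ρ = inp (a.val inp ρ) := rfl

theorem Expr.fits_ofNat : (no_index (OfNat.ofNat k) : Expr).Fits w inp ρ ↔ k < 2 ^ w := Iff.rfl
theorem Expr.fits_add : (a + b).Fits w inp ρ ↔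
    a.Fits w inp ρ ∧ b.Fits w inp ρ ∧ a.val inp ρ + b.val inp ρ < 2 ^ w := Iff.rfl
theorem Expr.fits_sub : (a - b).Fits w inp ρ ↔
    a.Fits w inp ρ ∧ b.Fits w inp ρ ∧ b.val inp ρ ≤ a.val inp ρ := Iff.rfl
theorem Expr.fits_mul : (a * b).Fits w inp ρ ↔
    a.Fits w inp ρ ∧ b.Fits w inp ρ ∧ a.val inp ρ * b.val inp ρ < 2 ^ w := Iff.rfl
theorem Expr.fits_mod : (a % b).Fits w inp ρ ↔ a.Fits w inp ρ ∧ b.Fits w inp ρ := by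
  change _ ∧ _ ∧ True ↔ _
  rw [and_true]
theorem Expr.fits_var (a : Var) : (Expr.var a).Fits w inp ρ ↔ True := Iff.rfl
theorem Expr.fits_input : (Expr.input a).Fits w inp ρ ↔ a.Fits w inp ρ := Iff.rfl

theorem Expr.cost_ofNat : (no_index (OfNat.ofNat k) : Expr).cost = 1 := rfl
theorem Expr.cost_add : (a + b).cost = a.cost + b.cost + 1 := rfl
theorem Expr.cost_sub : (a - b).cost = a.cost + b.cost + 1 := rfl
theorem Expr.cost_mul : (a * b).cost = a.cost + b.cost + 1 := rfl
theorem Expr.cost_mod : (a % b).cost = a.cost + b.cost + 1 := rfl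
theorem Expr.cost_var (a : Var) : (Expr.var a).cost = 1 := rfl
theorem Expr.cost_input : (Expr.input a).cost = a.cost + 1 := rfl
end

inductive Cond where
  | lt (a b : Var)
  | le (a b : Var)
  | eq (a b : Var)
  | ne (a b : Var)

def Cond.toTest : Cond → Test
  | lt a b => .lt a.idx b.idx
  | le a b => .le a.idx b.idx
  | eq a b => .eq a.idx b.idx
  | ne a b => .ne a.idx b.idx

def Cond.Holds (ρ : Var → ℕ) : Cond → Prop
  | lt a b => ρ a < ρ b
  | le a b => ρ a ≤ ρ b
  | eq a b => ρ a = ρ b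
  | ne a b => ρ a ≠ ρ b

/-- Fields of the algorithm do not respect word boundaries. Bit addressing hides this from its
analysis; only the translation of `rd` and `wr` has to deal with words. -/
inductive Cmd where
  | skip
  /-- assign a value to a variable -/
  | set (d : Var) (e : Expr)
  /-- output a value -/
  | out (e : Expr)
  /-- read the `f` bits at bit address `a` into the variable `d` -/
  | rd (d : Var) (a f : Expr)
  /-- write `s` to the `f` bits at bit address `a` -/
  | wr (a f s : Expr)
  | seq (c₁ c₂ : Cmd)
  | ite (b : Cond) (c₁ c₂ : Cmd)
  | loop (b : Cond) (c : Cmd)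

infixr:60 ";;" => Cmd.seq

/-- Configurations of a program that sees its working memory as an array of bits. -/
structure BState where
  reg : Var → ℕ
  mem : ℕ → Bool
  out : List ℕ
  time : ℕ

def BState.tick (A : BState) : BState := { A with time := A.time + 1 }

/-- The twelve instructions of `fetchCode` and a final move. -/
def readTime : ℕ := 13

/-- The twelve instructions of `fetchCode` and the ten of `replaceCode`. -/
def writeTime : ℕ := 22

/-- Weakest precondition of a loop with condition `b` whose body has the predicate transformer
`body`. -/
inductive LoopWP (b : Cond) (body : (BState → Prop) → BState → Prop) (Q : BState → Prop) :
    BState → Prop where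
  | done {A : BState} : ¬ b.Holds A.reg → Q A.tick → LoopWP b body Q A
  | step {A : BState} (R : BState → Prop) : b.Holds A.reg → body R A.tick →
      (∀ B, R B → LoopWP b body Q B) → LoopWP b body Q A

/-- Weakest precondition, for bit addresses up to `N`. -/
def Cmd.wp (w : ℕ) (inp : ℕ → ℕ) (N : ℕ) : Cmd → (BState → Prop) → BState → Prop
  | skip, Q, A => Q A
  | set d e, Q, A => e.Fits w inp A.reg ∧
      Q { A with reg := Function.update A.reg d (e.val inp A.reg), time := A.time + e.cost + 1 }
  | out e, Q, A => e.Fits w inp A.reg ∧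
      Q { A with out := A.out ++ [e.val inp A.reg], time := A.time + e.cost + 1 }
  | rd d a f, Q, A => a.Fits w inp A.reg ∧ f.Fits w inp A.reg ∧
      a.val inp A.reg ≤ N ∧ f.val inp A.reg < w ∧
      Q { A with
            reg := Function.update A.reg d (readBits A.mem (a.val inp A.reg) (f.val inp A.reg)),
            time := A.time + (a.cost + f.cost + readTime) }
  | wr a f s, Q, A => a.Fits w inp A.reg ∧ f.Fits w inp A.reg ∧ s.Fits w inp A.reg ∧
      a.val inp A.reg ≤ N ∧ f.val inp A.reg < w ∧ s.val inp A.reg < 2 ^ (f.val inp A.reg) ∧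
      Q { A with
            mem := writeBits A.mem (a.val inp A.reg) (f.val inp A.reg) (s.val inp A.reg),
            time := A.time + (a.cost + f.cost + s.cost + writeTime) }
  | seq c₁ c₂, Q, A => c₁.wp w inp N (c₂.wp w inp N Q) A
  | ite b c₁ c₂, Q, A => (b.Holds A.reg → c₁.wp w inp N Q A.tick) ∧
      (¬ b.Holds A.reg → c₂.wp w inp N Q A.tick)
  | loop b c, Q, A => LoopWP b (c.wp w inp N) Q A

/-! ## Translation to word RAM programs -/

def block : List Instr → Program
  | [] => .skip
  | i :: l => .seq (.instr i) (block l)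

def execList (w : ℕ) (inp : ℕ → ℕ) : List Instr → State → State
  | [], σ => σ
  | i :: l, σ => execList w inp l (i.exec w inp σ)

theorem runs_block (w : ℕ) (inp : ℕ → ℕ) (l : List Instr) (σ : State) :
    (block l).Runs w inp σ (execList w inp l σ) := by
  induction l generalizing σ with
  | nil => exact .skip σ
  | cons i l ih => exact .seq (.instr i σ) (ih _)

/-- All registers and working cells hold words. -/
structure Bounded (w : ℕ) (σ : State) : Prop where
  reg : ∀ r, σ.reg r < 2 ^ w
  work : ∀ a, σ.work a < 2 ^ w

theorem Bounded.tick {w : ℕ} {σ : State} (h : Bounded w σ) : Bounded w σ.tick :=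
  ⟨h.reg, h.work⟩

theorem Bounded.exec {w : ℕ} {inp : ℕ → ℕ} {σ : State} (hinp : ∀ a, inp a < 2 ^ w)
    (h : Bounded w σ) (i : Instr) : Bounded w (i.exec w inp σ) := by
  have hpos : 0 < 2 ^ w := by positivity
  have upd : ∀ (g : ℕ → ℕ) (d x : ℕ), (∀ r, g r < 2 ^ w) → x < 2 ^ w →
      ∀ r, Function.update g d x r < 2 ^ w := by
    intro g d x hg hx r
    rw [Function.update_apply]
    split_ifs
    exacts [hx, hg r]
  cases i with
  | const d k => exact ⟨upd _ _ _ h.reg (Nat.mod_lt _ hpos), h.work⟩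
  | move d a => exact ⟨upd _ _ _ h.reg (h.reg a), h.work⟩
  | op o d a b =>
    refine ⟨upd _ _ _ h.reg ?_, h.work⟩
    cases o <;> exact Nat.mod_lt _ hpos
  | readInput d a => exact ⟨upd _ _ _ h.reg (hinp _), h.work⟩
  | load d a => exact ⟨upd _ _ _ h.reg (h.work _), h.work⟩
  | store a s => exact ⟨h.reg, upd _ _ _ h.work (h.reg s)⟩
  | output s => exact ⟨h.reg, h.work⟩

theorem Bounded.runs {w : ℕ} {inp : ℕ → ℕ} (hinp : ∀ a, inp a < 2 ^ w) {P : Program}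
    {σ τ : State} (hr : P.Runs w inp σ τ) (h : Bounded w σ) : Bounded w τ := by
  induction hr with
  | skip => exact h
  | instr i σ => exact h.exec hinp i
  | seq _ _ ih₁ ih₂ => exact ih₂ (ih₁ h)
  | ite_true _ _ ih => exact ih h.tick
  | ite_false _ _ ih => exact ih h.tick
  | loop_true _ _ _ ih₁ ih₂ => exact ih₂ (ih₁ h.tick)
  | loop_false => exact h.tick

/-- Code that evaluates an expression into register `t`, using registers from `t` on. -/
def Expr.code : Expr → ℕ → Program
  | const k, t => .instr (.const t k)
  | var a, t => .instr (.move t a.idx)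
  | arith o a b, t => .seq (a.code t) (.seq (b.code (t + 1)) (.instr (.op o.toOp t t (t + 1))))
  | input a, t => .seq (a.code t) (.instr (.readInput t t))

/-- Registers from `t` on serve as an evaluation stack. Preservation of all registers below `t`
protects both the variables and the left operand while the right one is evaluated. -/
theorem Expr.code_runs {w : ℕ} {inp : ℕ → ℕ} (hinp : ∀ a, inp a < 2 ^ w) {ρ : Var → ℕ} (e : Expr)
    (he : e.Fits w inp ρ) {t : ℕ} (ht : 40 ≤ t) {σ : State} (hσ : ∀ a : Var, σ.reg a.idx = ρ a)
    (hb : Bounded w σ) :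
    ∃ τ, (e.code t).Runs w inp σ τ ∧ τ.reg t = e.val inp ρ ∧ (∀ r < t, τ.reg r = σ.reg r) ∧
      τ.work = σ.work ∧ τ.out = σ.out ∧ τ.time = σ.time + e.cost ∧ τ.cells = σ.cells := by
  induction e generalizing t σ with
  | const k =>
    refine ⟨_, .instr _ _, ?_, ?_, rfl, rfl, rfl, rfl⟩
    · simpa [Instr.exec, State.setReg, State.tick, Expr.val] using Nat.mod_eq_of_lt he
    · intro r hr
      simp [Instr.exec, State.setReg, State.tick, hr.ne]
  | var a =>
    refine ⟨_, .instr _ _, ?_, ?_, rfl, rfl, rfl, rfl⟩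
    · simpa [Instr.exec, State.setReg, State.tick, Expr.val] using hσ a
    · intro r hr
      simp [Instr.exec, State.setReg, State.tick, hr.ne]
  | arith o a b iha ihb =>
    obtain ⟨ha, hb', hfit⟩ := he
    obtain ⟨σ₁, r₁, v₁, f₁, w₁, o₁, t₁, c₁⟩ := iha ha ht hσ hb
    have hb₁ := hb.runs hinp r₁
    obtain ⟨σ₂, r₂, v₂, f₂, w₂, o₂, t₂, c₂⟩ := ihb hb' (t := t + 1) (by omega)
      (fun x => (f₁ _ (x.idx_lt.trans_le ht)).trans (hσ x)) hb₁
    have hb₂ := hb₁.runs hinp r₂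
    refine ⟨_, .seq r₁ (.seq r₂ (.instr _ _)), ?_, ?_, w₂.trans w₁, o₂.trans o₁, ?_, c₂.trans c₁⟩
    · have e₁ : σ₂.reg t = a.val inp ρ := by rw [f₂ t (by omega), v₁]
      simp only [Instr.exec, State.setReg, State.tick, Function.update_self, Expr.val]
      rw [Arith.eval_toOp o (hb₂.reg _) (by rw [e₁, v₂]; exact hfit), e₁, v₂]
    · intro r hr
      simp [Instr.exec, State.setReg, State.tick, hr.ne, f₂ r (by omega), f₁ r hr]
    · simp only [Instr.exec, State.setReg, State.tick, Expr.cost, t₂, t₁]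
      omega
  | input a iha =>
    obtain ⟨σ₁, r₁, v₁, f₁, w₁, o₁, t₁, c₁⟩ := iha he ht hσ hb
    refine ⟨_, .seq r₁ (.instr _ _), ?_, ?_, w₁, o₁, ?_, c₁⟩
    · simp [Instr.exec, State.setReg, State.tick, Expr.val, v₁]
    · intro r hr
      simp [Instr.exec, State.setReg, State.tick, hr.ne, f₁ r hr]
    · simp only [Instr.exec, State.setReg, State.tick, Expr.cost, t₁]
      omega

/-- Read into register `47` the field whose bit address is in register `40` and whose length is in
register `41`; registers `43`, `44` and `48` end up with the index of the second word involved,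
the offset in the first word, and the number of bits from there to the end of that word. -/
def fetchCode : List Instr :=
  [.op .div 43 40 1, .op .mod 44 40 1, .load 45 43, .op .shr 45 45 44, .const 46 1,
    .op .add 43 43 46, .load 47 43, .op .sub 48 1 44, .op .shl 47 47 48, .op .or 45 45 47,
    .op .shl 46 46 41, .op .mod 47 45 46]

/-- After `fetchCode`, replace the field by the contents of register `42`. -/
def replaceCode : List Instr :=
  [.op .xor 47 47 42, .op .shr 46 47 48, .load 45 43, .op .xor 45 45 46, .store 43 45,
    .op .div 43 40 1, .load 45 43, .op .shl 46 47 44, .op .xor 45 45 46, .store 43 45]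

/-- The bits of a memory of `w`-bit words. -/
def bits (w : ℕ) (work : ℕ → ℕ) : ℕ → Bool := fun p => (work (p / w)).testBit (p % w)

/-- A field shorter than a word meets at most two consecutive words. The first is shifted down by
the offset `p % w`, the second up by the complementary amount; if the offset is `0`, the second is
shifted out entirely. The last reduction cuts off the bits beyond the field. -/
theorem fetch_value {w : ℕ} {work : ℕ → ℕ} (hwork : ∀ a, work a < 2 ^ w) {p f : ℕ} (hf : f < w) :
    ((((work (p / w) >>> (p % w)) % 2 ^ w) ||| ((work (p / w + 1) <<< (w - p % w)) % 2 ^ w))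
      % 2 ^ w) % 2 ^ f = readBits (bits w work) p f := by
  apply Nat.eq_of_testBit_eq
  intro i
  have hs : p % w < w := Nat.mod_lt _ (by omega)
  rw [testBit_readBits]
  by_cases hi : i < f
  · have hiw : i < w := by omega
    simp only [Nat.testBit_mod_two_pow, Nat.testBit_or, Nat.testBit_shiftRight,
      Nat.testBit_shiftLeft, hi, hiw, decide_true, Bool.true_and, bits]
    have hp : p + i = w * (p / w) + (p % w + i) := by
      have := Nat.div_add_mod p w
      omega
    by_cases h : p % w + i < w
    · have e₁ : (p + i) / w = p / w := by
        rw [hp, Nat.mul_add_div (by omega), Nat.div_eq_of_lt h, add_zero]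
      have e₂ : (p + i) % w = p % w + i := by
        rw [hp, Nat.mul_add_mod, Nat.mod_eq_of_lt h]
      rw [e₁, e₂]
      simp [show ¬ (w - p % w ≤ i) by omega]
    · have e₀ : p + i = w * (p / w + 1) + (p % w + i - w) := by
        rw [mul_add, mul_one]; omega
      have e₁ : (p + i) / w = p / w + 1 := by
        rw [e₀, Nat.mul_add_div (show 0 < w by omega),
          Nat.div_eq_of_lt (show p % w + i - w < w by omega), add_zero]
      have e₂ : (p + i) % w = p % w + i - w := by
        rw [e₀, Nat.mul_add_mod, Nat.mod_eq_of_lt (show p % w + i - w < w by omega)]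
      rw [e₁, e₂, Nat.testBit_eq_false_of_lt (i := p % w + i)
        ((hwork _).trans_le (Nat.pow_le_pow_right (by norm_num) (by omega)))]
      simp [show w - p % w ≤ i by omega, show i - (w - p % w) = p % w + i - w by omega]
  · simp [hi]

/-- The xor of the old and the new field contents marks the bits to be flipped. Shifted into place,
it is xored into both words, so no masks are needed. -/
theorem replace_value {w : ℕ} {work : ℕ → ℕ} {p f x : ℕ}
    (hf : f < w) (hx : x < 2 ^ f) :
    bits w (Function.update (Function.update work (p / w + 1)
        ((work (p / w + 1) ^^^ (((readBits (bits w work) p f ^^^ x) % 2 ^ w) >>> (w - p % w)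
          % 2 ^ w)) % 2 ^ w)) (p / w)
        ((work (p / w) ^^^ (((readBits (bits w work) p f ^^^ x) % 2 ^ w) <<< (p % w)
          % 2 ^ w)) % 2 ^ w)) =
      writeBits (bits w work) p f x := by
  have hw : 0 < w := by omega
  have hs : p % w < w := Nat.mod_lt _ hw
  have hpd := Nat.div_add_mod p w
  have hxf : ∀ i, f ≤ i → x.testBit i = false := fun i hi =>
    Nat.testBit_eq_false_of_lt (hx.trans_le (Nat.pow_le_pow_right (by norm_num) hi))
  funext q
  have hq := Nat.div_add_mod q w
  have hqs : q % w < w := Nat.mod_lt _ hw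
  unfold writeBits
  by_cases h₁ : q / w = p / w
  · simp only [bits, h₁, Function.update_self, Nat.testBit_mod_two_pow, Nat.testBit_xor,
      Nat.testBit_shiftLeft, hqs, decide_true, Bool.true_and]
    rw [h₁] at hq
    by_cases h : p % w ≤ q % w
    · rw [testBit_readBits]
      have e : q % w - p % w = q - p := by omega
      have e' : p + (q - p) = q := by omega
      simp only [h, decide_true, Bool.true_and, e, e', show q - p < w by omega]
      by_cases h' : q < p + f
      · simp [show p ≤ q by omega, h', show q - p < f by omega, bits, h₁]
      · simp [h', show ¬ q - p < f by omega, hxf (q - p) (by omega)]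
    · simp [h, show ¬ p ≤ q by omega]
  by_cases h₂ : q / w = p / w + 1
  · simp only [bits, h₂]
    rw [Function.update_of_ne (by omega), Function.update_self]
    rw [h₂, mul_add, mul_one] at hq
    have e : w - p % w + q % w = q - p := by omega
    have e' : p + (q - p) = q := by omega
    simp only [Nat.testBit_mod_two_pow, Nat.testBit_xor, Nat.testBit_shiftRight, hqs,
      decide_true, Bool.true_and, e, testBit_readBits, e']
    by_cases h' : q < p + f
    · simp [show p ≤ q by omega, h', show q - p < f by omega, show q - p < w by omega, bits, h₂]
    · simp [h', show ¬ q - p < f by omega, hxf (q - p) (by omega)]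
  -- As `f < w`, no bit of the field lies outside the words `p / w` and `p / w + 1`.
  · have : ¬ (p ≤ q ∧ q < p + f) := by
      rintro ⟨ha, hb⟩
      have h3 : p / w ≤ q / w := Nat.div_le_div_right ha
      have h4 : q / w < p / w + 2 := by
        rw [Nat.div_lt_iff_lt_mul hw, add_mul, mul_comm]
        omega
      omega
    simp [bits, h₁, h₂, this]

theorem fetch_exec {w : ℕ} {inp : ℕ → ℕ} {σ : State} (hb : Bounded w σ) (hw : σ.reg 1 = w)
    {p f : ℕ} (hp : σ.reg 40 = p) (hf : σ.reg 41 = f) (hfw : f < w) (hpw : p / w + 1 < 2 ^ w) :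
    ∃ τ, execList w inp fetchCode σ = τ ∧ τ.reg 47 = readBits (bits w σ.work) p f ∧
      τ.reg 43 = p / w + 1 ∧ τ.reg 44 = p % w ∧ τ.reg 48 = w - p % w ∧
      (∀ r < 43, τ.reg r = σ.reg r) ∧ τ.work = σ.work ∧ τ.out = σ.out ∧
      τ.time = σ.time + 12 ∧ τ.cells = max σ.cells (p / w + 2) := by
  have hs : p % w < w := Nat.mod_lt _ (by omega)
  have hww : w < 2 ^ w := Nat.lt_two_pow_self
  have h1 : 1 % 2 ^ w = 1 := Nat.mod_eq_of_lt (by omega)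
  have hd : p / w % 2 ^ w = p / w := Nat.mod_eq_of_lt (by omega)
  have hm : p % w % 2 ^ w = p % w := Nat.mod_eq_of_lt (by omega)
  have hd1 : (p / w + 1) % 2 ^ w = p / w + 1 := Nat.mod_eq_of_lt hpw
  have hsub : (w + (2 ^ w - p % w)) % 2 ^ w = w - p % w := by
    rw [show w + (2 ^ w - p % w) = (w - p % w) + 2 ^ w by omega, Nat.add_mod_right,
      Nat.mod_eq_of_lt (by omega)]
  have hff : 2 ^ f < 2 ^ w := Nat.pow_lt_pow_right (by norm_num) hfw
  have hsh : 1 <<< f % 2 ^ w = 2 ^ f := by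
    rw [Nat.shiftLeft_eq, one_mul, Nat.mod_eq_of_lt hff]
  have hval := fetch_value hb.work (p := p) hfw
  refine ⟨_, rfl, ?_, ?_, ?_, ?_, ?_, rfl, rfl, rfl, ?_⟩
  · simp only [fetchCode, execList, Instr.exec, State.setReg, State.tick, State.touch, Op.eval,
      Function.update_apply, hp, hf, hw, hd, hm, h1, hd1, hsub, hsh, reduceIte,
      Nat.reduceEqDiff, OfNat.one_ne_ofNat]
    rw [hval]
    exact Nat.mod_eq_of_lt ((readBits_lt _ _ _).trans hff)
  · simp [fetchCode, execList, Instr.exec, State.setReg, State.tick, State.touch, Op.eval,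
      hp, hw, hd, h1, hd1]
  · simp [fetchCode, execList, Instr.exec, State.setReg, State.tick, State.touch, Op.eval,
      hp, hw, hm]
  · simp [fetchCode, execList, Instr.exec, State.setReg, State.tick, State.touch, Op.eval,
      hp, hw, hm, hsub]
  · intro r hr
    have hne : ∀ k, 43 ≤ k → r ≠ k := fun k hk => by omega
    simp [fetchCode, execList, Instr.exec, State.setReg, State.tick, State.touch,
      hne]
  · simp [fetchCode, execList, Instr.exec, State.setReg, State.tick, State.touch, Op.eval,
      hp, hw, hd, h1, hd1, max_assoc]

theorem replace_exec {w : ℕ} {inp : ℕ → ℕ} {σ : State} (hw : σ.reg 1 = w)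
    {p f x : ℕ} (hp : σ.reg 40 = p) (hx : σ.reg 42 = x) (hfw : f < w) (hxf : x < 2 ^ f)
    (hpw : p / w + 1 < 2 ^ w) (h47 : σ.reg 47 = readBits (bits w σ.work) p f)
    (h43 : σ.reg 43 = p / w + 1) (h44 : σ.reg 44 = p % w) (h48 : σ.reg 48 = w - p % w) :
    ∃ τ, execList w inp replaceCode σ = τ ∧ bits w τ.work = writeBits (bits w σ.work) p f x ∧
      (∀ r < 43, τ.reg r = σ.reg r) ∧ τ.out = σ.out ∧
      τ.time = σ.time + 10 ∧ τ.cells = max σ.cells (p / w + 2) := by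
  have hd : p / w % 2 ^ w = p / w := Nat.mod_eq_of_lt (by omega)
  refine ⟨_, rfl, ?_, ?_, rfl, rfl, ?_⟩
  · rw [← replace_value hfw hxf]
    simp [replaceCode, execList, Instr.exec, State.setReg, State.tick, State.touch, Op.eval,
      hp, hx, hw, h47, h43, h44, h48, hd]
  · intro r hr
    have hne : ∀ k, 43 ≤ k → r ≠ k := fun k hk => by omega
    simp [replaceCode, execList, Instr.exec, State.setReg, State.tick, State.touch,
      hne]
  · simp [replaceCode, execList, Instr.exec, State.setReg, State.tick, State.touch, Op.eval,
      hp, hw, h43, hd]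

def Cmd.code : Cmd → Program
  | skip => .skip
  | set d e => .seq (e.code 40) (.instr (.move d.idx 40))
  | out e => .seq (e.code 40) (.instr (.output 40))
  | rd d a f =>
      .seq (a.code 40) (.seq (f.code 41) (.seq (block fetchCode) (.instr (.move d.idx 47))))
  | wr a f s =>
      .seq (a.code 40) (.seq (f.code 41) (.seq (s.code 42)
        (.seq (block fetchCode) (block replaceCode))))
  | seq c₁ c₂ => .seq c₁.code c₂.code
  | ite b c₁ c₂ => .ite b.toTest c₁.code c₂.code
  | loop b c => .loop b.toTest c.code

/-- The bit-level configuration `A` describes `σ`, and only bit addresses up to `N` have been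
used. -/
structure Describes (w N : ℕ) (A : BState) (σ : State) : Prop where
  bounded : Bounded w σ
  wordSize : σ.reg 1 = w
  reg : ∀ a : Var, σ.reg a.idx = A.reg a
  mem : bits w σ.work = A.mem
  out : σ.out = A.out
  time : σ.time = A.time
  cells : σ.cells ≤ N / w + 2

theorem Describes.tick {w N : ℕ} {A : BState} {σ : State} (h : Describes w N A σ) :
    Describes w N A.tick σ.tick :=
  ⟨h.bounded.tick, h.wordSize, h.reg, h.mem, h.out, congrArg (· + 1) h.time, h.cells⟩

theorem Describes.holds_iff {w N : ℕ} {A : BState} {σ : State} (h : Describes w N A σ)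
    (b : Cond) : b.toTest.Holds σ ↔ b.Holds A.reg := by
  cases b <;> simp [Cond.toTest, Test.Holds, Cond.Holds, h.reg]

/-- The bound on `N` makes the index of the second word of every accessed field a word. That word is
touched even by fields contained in the first one, whence the `N / w + 2` cells in `Describes`. -/
theorem Cmd.code_runs {w N : ℕ} {inp : ℕ → ℕ} (hinp : ∀ a, inp a < 2 ^ w) (hN : N + 1 < 2 ^ w)
    (c : Cmd) {Q : BState → Prop} {A : BState} {σ : State} (hσ : Describes w N A σ)
    (h : c.wp w inp N Q A) :
    ∃ τ B, c.code.Runs w inp σ τ ∧ Describes w N B τ ∧ Q B := by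
  induction c generalizing Q A σ with
  | skip => exact ⟨σ, A, .skip σ, hσ, h⟩
  | set d e =>
    obtain ⟨he, hQ⟩ := h
    obtain ⟨τ, hr, hv, hf, hwk, ho, ht, hc⟩ := e.code_runs hinp he le_rfl hσ.reg hσ.bounded
    have hrun := Program.Runs.seq hr (.instr (.move d.idx 40) τ)
    refine ⟨_, _, hrun, ⟨hσ.bounded.runs hinp hrun, ?_, ?_, ?_, ?_, ?_, ?_⟩, hQ⟩
    · simp [Instr.exec, State.setReg, State.tick, d.idx_ne_one.symm, hf, hσ.wordSize]
    · intro a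
      simp [Instr.exec, State.setReg, State.tick, Function.update_apply, Var.idx_inj, hv,
        hf _ a.idx_lt, hσ.reg]
    · exact (congrArg (bits w) hwk).trans hσ.mem
    · exact ho.trans hσ.out
    · simp [Instr.exec, State.setReg, State.tick, ht, hσ.time]
    · exact hc.le.trans hσ.cells
  | out e =>
    obtain ⟨he, hQ⟩ := h
    obtain ⟨τ, hr, hv, hf, hwk, ho, ht, hc⟩ := e.code_runs hinp he le_rfl hσ.reg hσ.bounded
    have hrun := Program.Runs.seq hr (.instr (.output 40) τ)
    refine ⟨_, _, hrun, ⟨hσ.bounded.runs hinp hrun, ?_, ?_, ?_, ?_, ?_, ?_⟩, hQ⟩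
    · simp [Instr.exec, State.tick, hf, hσ.wordSize]
    · intro a
      simp [Instr.exec, State.tick, hf _ a.idx_lt, hσ.reg]
    · exact (congrArg (bits w) hwk).trans hσ.mem
    · simp [Instr.exec, State.tick, ho, hσ.out, hv]
    · simp [Instr.exec, State.tick, ht, hσ.time]
    · exact hc.le.trans hσ.cells
  | rd d a f =>
    obtain ⟨ha, hf, haN, hfw, hQ⟩ := h
    obtain ⟨σ₁, r₁, v₁, f₁, w₁, o₁, t₁, c₁⟩ := a.code_runs hinp ha le_rfl hσ.reg hσ.bounded
    have hb₁ := hσ.bounded.runs hinp r₁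
    obtain ⟨σ₂, r₂, v₂, f₂, w₂, o₂, t₂, c₂⟩ := f.code_runs hinp hf (t := 41) (by norm_num)
      (fun x => (f₁ _ x.idx_lt).trans (hσ.reg x)) hb₁
    have hb₂ := hb₁.runs hinp r₂
    have hdiv : a.val inp A.reg / w ≤ N / w := Nat.div_le_div_right haN
    have hdiv' : N / w ≤ N := Nat.div_le_self _ _
    obtain ⟨σ₃, r₃, v₃, -, -, -, f₃, w₃, o₃, t₃, c₃⟩ := fetch_exec (inp := inp) hb₂
      (by rw [f₂ 1 (by norm_num), f₁ 1 (by norm_num), hσ.wordSize])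
      (by rw [f₂ 40 (by norm_num), v₁]) v₂ hfw (by omega)
    have hrun := Program.Runs.seq r₁ (.seq r₂ (.seq (r₃ ▸ runs_block w inp fetchCode σ₂)
      (.instr (.move d.idx 47) σ₃)))
    refine ⟨_, _, hrun, ⟨hσ.bounded.runs hinp hrun, ?_, ?_, ?_, ?_, ?_, ?_⟩, hQ⟩
    · simp [Instr.exec, State.setReg, State.tick, d.idx_ne_one.symm, f₁, f₂, f₃, hσ.wordSize]
    · intro x
      have := x.idx_lt
      simp [Instr.exec, State.setReg, State.tick, Function.update_apply, Var.idx_inj, v₃,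
        f₁ x.idx (by omega), f₂ x.idx (by omega), f₃ x.idx (by omega), hσ.reg, w₂, w₁, hσ.mem]
    · exact (congrArg (bits w) (w₃.trans (w₂.trans w₁))).trans hσ.mem
    · exact o₃.trans (o₂.trans (o₁.trans hσ.out))
    · simp [Instr.exec, State.setReg, State.tick, t₁, t₂, t₃, hσ.time, readTime]
      omega
    · have := hσ.cells
      simp only [Instr.exec, State.setReg, State.tick, c₃, c₂, c₁]
      omega
  | wr a f s =>
    obtain ⟨ha, hf, hs, haN, hfw, hsf, hQ⟩ := h
    obtain ⟨σ₁, r₁, v₁, f₁, w₁, o₁, t₁, c₁⟩ := a.code_runs hinp ha le_rfl hσ.reg hσ.bounded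
    have hb₁ := hσ.bounded.runs hinp r₁
    obtain ⟨σ₂, r₂, v₂, f₂, w₂, o₂, t₂, c₂⟩ := f.code_runs hinp hf (t := 41) (by norm_num)
      (fun x => (f₁ _ x.idx_lt).trans (hσ.reg x)) hb₁
    have hb₂ := hb₁.runs hinp r₂
    obtain ⟨σ₃, r₃, v₃, f₃, w₃, o₃, t₃, c₃⟩ := s.code_runs hinp hs (t := 42) (by norm_num)
      (fun x => (f₂ _ (by have := x.idx_lt; omega)).trans ((f₁ _ x.idx_lt).trans (hσ.reg x))) hb₂
    have hb₃ := hb₂.runs hinp r₃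
    have hdiv : a.val inp A.reg / w ≤ N / w := Nat.div_le_div_right haN
    have hdiv' : N / w ≤ N := Nat.div_le_self _ _
    obtain ⟨σ₄, r₄, v₄, g₁, g₂, g₃, f₄, w₄, o₄, t₄, c₄⟩ := fetch_exec (inp := inp) hb₃
      (by rw [f₃ 1 (by norm_num), f₂ 1 (by norm_num), f₁ 1 (by norm_num), hσ.wordSize])
      (by rw [f₃ 40 (by norm_num), f₂ 40 (by norm_num), v₁])
      (by rw [f₃ 41 (by norm_num), v₂]) hfw (by omega)
    obtain ⟨σ₅, r₅, v₅, f₅, o₅, t₅, c₅⟩ := replace_exec (inp := inp)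
      (by rw [f₄ 1 (by norm_num), f₃ 1 (by norm_num), f₂ 1 (by norm_num), f₁ 1 (by norm_num),
        hσ.wordSize])
      (by rw [f₄ 40 (by norm_num), f₃ 40 (by norm_num), f₂ 40 (by norm_num), v₁])
      (by rw [f₄ 42 (by norm_num), v₃]) hfw hsf (by omega) (by rw [w₄]; exact v₄) g₁ g₂ g₃
    have hrun := Program.Runs.seq r₁ (.seq r₂ (.seq r₃ (.seq
      (r₄ ▸ runs_block w inp fetchCode σ₃) (r₅ ▸ runs_block w inp replaceCode σ₄))))
    refine ⟨_, _, hrun, ⟨hσ.bounded.runs hinp hrun, ?_, ?_, ?_, ?_, ?_, ?_⟩, hQ⟩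
    · simp [f₁, f₂, f₃, f₄, f₅, hσ.wordSize]
    · intro x
      have := x.idx_lt
      simp [f₁ x.idx (by omega), f₂ x.idx (by omega), f₃ x.idx (by omega), f₄ x.idx (by omega),
        f₅ x.idx (by omega), hσ.reg]
    · rw [v₅, w₄, w₃, w₂, w₁, hσ.mem]
    · rw [o₅, o₄, o₃, o₂, o₁, hσ.out]
    · simp only [t₁, t₂, t₃, t₄, t₅, hσ.time, writeTime]
      omega
    · have := hσ.cells
      simp only [c₅, c₄, c₃, c₂, c₁]
      omega
  | seq c₁ c₂ ih₁ ih₂ =>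
    obtain ⟨τ, B, hr, hB, hQ⟩ := ih₁ hσ h
    obtain ⟨υ, C, hr', hC, hQ'⟩ := ih₂ hB hQ
    exact ⟨υ, C, .seq hr hr', hC, hQ'⟩
  | ite b c₁ c₂ ih₁ ih₂ =>
    by_cases hb : b.Holds A.reg
    · obtain ⟨τ, B, hr, hB⟩ := ih₁ hσ.tick (h.1 hb)
      exact ⟨τ, B, .ite_true ((hσ.holds_iff b).2 hb) hr, hB⟩
    · obtain ⟨τ, B, hr, hB⟩ := ih₂ hσ.tick (h.2 hb)
      exact ⟨τ, B, .ite_false (mt (hσ.holds_iff b).1 hb) hr, hB⟩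
  | loop b c ih =>
    change LoopWP b (c.wp w inp N) Q A at h
    -- Derivations of `LoopWP` are well-founded, so induction on them yields termination along with
    -- correctness.
    induction h generalizing σ with
    | @done A hb hA =>
      exact ⟨_, _, .loop_false (mt (hσ.holds_iff b).1 hb), hσ.tick, hA⟩
    | @step A R hb hR _ ih' =>
      obtain ⟨τ, B, hr, hB, hRB⟩ := ih hσ.tick hR
      obtain ⟨υ, C, hr', hC, hQ⟩ := ih' B hRB hB
      exact ⟨υ, C, .loop_true ((hσ.holds_iff b).2 hb) hr hr', hC, hQ⟩

end WordRAM

namespace WordRAM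

/-! ## The program -/

prefix:max "◇" => Expr.var

attribute [simp] Cmd.wp Cond.Holds BState.tick readTime writeTime
  Expr.val_ofNat Expr.val_add Expr.val_sub Expr.val_mul Expr.val_mod Expr.val_var Expr.val_input
  Expr.fits_ofNat Expr.fits_add Expr.fits_sub Expr.fits_mul Expr.fits_mod Expr.fits_var
  Expr.fits_input Expr.cost_ofNat Expr.cost_add Expr.cost_sub Expr.cost_mul Expr.cost_mod
  Expr.cost_var Expr.cost_input

/-- `len := min deg ell` -/
def fieldLength : Cmd :=
  .set .len ◇.deg ;; .ite (.lt .ell .len) (.set .len ◇.ell) .skip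

/-- If the current depth `dep` is a multiple of `ell`, record the current vertex and the top of
the stack of positions. -/
def checkpoint : Cmd :=
  .set .lvl (◇.dep % ◇.ell) ;;
  .ite (.eq .lvl .zero)
    (.wr (◇.ck + 2 * ◇.dep) ◇.ell ◇.cur ;; .wr (◇.ck + 2 * ◇.dep + ◇.ell) ◇.ell ◇.top) .skip

/-- Make the window of buffered levels start at least at `dep - ell`. -/
def slide : Cmd :=
  .set .lvl (◇.lo + ◇.ell) ;; .ite (.lt .lvl .dep) (.set .lo (◇.lo + 1)) .skip

/-- Descend from the current vertex to `nbr`. -/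
def descend : Cmd :=
  checkpoint ;;
  .wr (◇.num + ◇.dep % ◇.ell * ◇.ell) ◇.ell ◇.cur ;;
  fieldLength ;;
  .wr (◇.js + ◇.top) ◇.len ◇.pos ;;
  .set .top (◇.top + ◇.len) ;;
  .set .dep (◇.dep + 1) ;;
  slide ;;
  .wr ◇.nbr 1 1 ;;
  .out 0 ;;
  .out ◇.nbr ;;
  .set .cur ◇.nbr ;;
  .set .pos 0

/-- Rewrite the buffer entry of level `lvl`, whose vertex is `nbr`, and move on to the next
level. -/
def replay : Cmd :=
  .wr (◇.num + ◇.lvl % ◇.ell * ◇.ell) ◇.ell ◇.nbr ;;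
  .set .deg (.input (.input ◇.nbr)) ;;
  fieldLength ;;
  .rd .pos (◇.js + ◇.off) ◇.len ;;
  .set .off (◇.off + ◇.len) ;;
  .set .nbr (.input (.input ◇.nbr + 1 + ◇.pos)) ;;
  .set .lvl (◇.lvl + 1)

/-- Rebuild the buffer from the last checkpoint below the current depth. -/
def restore : Cmd :=
  .set .lvl (◇.dep - 1) ;;
  .set .lvl (◇.lvl - ◇.lvl % ◇.ell) ;;
  .set .lo ◇.lvl ;;
  .rd .nbr (◇.ck + 2 * ◇.lvl) ◇.ell ;;
  .rd .off (◇.ck + 2 * ◇.lvl + ◇.ell) ◇.ell ;;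
  .loop (.lt .lvl .dep) replay

/-- Return from the current vertex to its parent, which is in the buffer. -/
def ascend : Cmd :=
  .set .dep (◇.dep - 1) ;;
  .rd .cur (◇.num + ◇.dep % ◇.ell * ◇.ell) ◇.ell ;;
  .set .deg (.input (.input ◇.cur)) ;;
  fieldLength ;;
  .set .top (◇.top - ◇.len) ;;
  .rd .pos (◇.js + ◇.top) ◇.len ;;
  .set .pos (◇.pos + 1)

/-- One step of the search. -/
def searchStep : Cmd :=
  .set .deg (.input (.input ◇.cur)) ;;
  .ite (.lt .pos .deg)
    (.set .nbr (.input (.input ◇.cur + 1 + ◇.pos)) ;;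
      .rd .col ◇.nbr 1 ;;
      .ite (.eq .col .zero) descend (.set .pos (◇.pos + 1)))
    (.out 1 ;;
      .out ◇.cur ;;
      .ite (.eq .dep .zero) (.set .flag 0)
        (.ite (.eq .dep .lo) restore .skip ;; ascend))

/-- Search from `root`. -/
def search : Cmd :=
  .wr ◇.root 1 1 ;;
  .out 0 ;;
  .out ◇.root ;;
  .set .cur ◇.root ;;
  .set .pos 0 ;;
  .set .flag 1 ;;
  .loop (.ne .flag .zero) searchStep

def rootStep : Cmd :=
  .rd .col ◇.root 1 ;; .ite (.eq .col .zero) search .skip ;; .set .root (◇.root + 1)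

/-- Mark vertex `root` undiscovered and count its neighbours. -/
def clearStep : Cmd :=
  .wr ◇.root 1 0 ;;
  .set .total (◇.total + .input (.input ◇.root)) ;;
  .set .root (◇.root + 1)

def lengthStep : Cmd :=
  .set .pw (◇.pw + ◇.pw) ;; .set .ell (◇.ell + 1)

def setup : Cmd :=
  .set .total ◇.num ;;
  .loop (.lt .root .num) clearStep ;;
  .set .root 0 ;;
  .set .pw 1 ;;
  .loop (.le .pw .total) lengthStep ;;
  .set .ck (◇.num + ◇.ell * ◇.ell) ;;
  .set .js (◇.ck + (2 * ◇.num + 2 * ◇.ell))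

def dfs : Cmd := setup ;; .loop (.lt .root .num) rootStep

/-! ## Invariants -/

section
variable {n : ℕ} (adj : Fin n → List (Fin n)) (ℓ : ℕ)

/-- The number of bits for a position in the neighbour list of `u`. -/
def slot (u : Fin n) : ℕ := min (adj u).length ℓ

/-- The number of bits for the positions on a stack. -/
def offset (st : List (Fin n × ℕ)) : ℕ := (st.map fun e => slot adj ℓ e.1).sum

/-- The sum of all degrees. -/
def totalDegree : ℕ := ∑ u, (adj u).length

/-- Start of the checkpoints. -/
def ckBase (n ℓ : ℕ) : ℕ := n + ℓ * ℓ

/-- Start of the stack of positions. -/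
def jsBase (n ℓ : ℕ) : ℕ := ckBase n ℓ + (2 * n + 2 * ℓ)

/-- The words are long enough for all numbers that occur. -/
structure Sized (w : ℕ) (inp : ℕ → ℕ) : Prop where
  array : IsAdjacencyArray w adj inp
  ell_pos : 0 < ℓ
  total_lt : n + totalDegree adj < 2 ^ ℓ
  ell_lt : ℓ < w
  limit_lt : jsBase n ℓ + totalDegree adj + 1 < 2 ^ w

/-- `st` lists the proper ancestors of `v`, the parent first, each with the position of the next
vertex of the path in its list. -/
def IsPath : Fin n → List (Fin n × ℕ) → Prop
  | _, [] => True
  | v, e :: t => (adj e.1)[e.2]? = some v ∧ IsPath e.1 t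

/-- The memory contents that represent the stack `st` when its levels from `lo` up to `hi` are
buffered. -/
structure StackMem (M : ℕ → Bool) (lo hi : ℕ) (st : List (Fin n × ℕ)) : Prop where
  pos : ∀ pre e t, st = pre ++ e :: t →
    readBits M (jsBase n ℓ + offset adj ℓ t) (slot adj ℓ e.1) = e.2
  buf : ∀ pre e t, st = pre ++ e :: t → lo ≤ t.length → t.length < hi →
    readBits M (n + t.length % ℓ * ℓ) ℓ = e.1
  vertex : ∀ pre e t, st = pre ++ e :: t → t.length % ℓ = 0 →
    readBits M (ckBase n ℓ + 2 * t.length) ℓ = e.1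
  offset : ∀ pre e t, st = pre ++ e :: t → t.length % ℓ = 0 →
    readBits M (ckBase n ℓ + 2 * t.length + ℓ) ℓ = offset adj ℓ t

/-- The fixed registers and the colours, `S` being the set of discovered vertices
and `r` the root. -/
structure Ready (r : ℕ) (S : Finset (Fin n)) (ρ : Var → ℕ) (M : ℕ → Bool) : Prop where
  num : ρ .num = n
  ell : ρ .ell = ℓ
  ck : ρ .ck = ckBase n ℓ
  js : ρ .js = jsBase n ℓ
  zero : ρ .zero = 0
  root : ρ .root = r
  color : ∀ u : Fin n, M u = decide (u ∈ S)

/-- The registers and the memory when the search is at the vertex `v` with the stack `st`. -/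
structure OnPath (r : ℕ) (v : Fin n) (st : List (Fin n × ℕ)) (S : Finset (Fin n)) (ρ : Var → ℕ)
    (M : ℕ → Bool) : Prop extends Ready ℓ r S ρ M where
  cur : ρ .cur = v
  dep : ρ .dep = st.length
  lo_le : ρ .lo ≤ st.length
  le_lo : st.length ≤ ρ .lo + ℓ
  top : ρ .top = offset adj ℓ st
  flag : ρ .flag = 1
  path : IsPath adj v st
  nodup : (v :: st.map Prod.fst).Nodup
  discovered : ∀ u ∈ v :: st.map Prod.fst, u ∈ S
  stack : StackMem adj ℓ M (ρ .lo) st.length st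

/-- Moreover, the first `j` neighbours of `v` have been scanned. -/
structure Active (r : ℕ) (v : Fin n) (j : ℕ) (st : List (Fin n × ℕ)) (S : Finset (Fin n))
    (ρ : Var → ℕ) (M : ℕ → Bool) : Prop extends OnPath adj ℓ r v st S ρ M where
  pos : ρ .pos = j
  pos_le : j ≤ (adj v).length

end

/-- The time used, plus the cost of filling up the buffer. -/
def potential (ℓ : ℕ) (A : BState) : ℕ := A.time + 100 * (ℓ + A.reg .lo - A.reg .dep)

section
variable {n : ℕ} {adj : Fin n → List (Fin n)} {ℓ : ℕ}

theorem slot_le_ell (u : Fin n) : slot adj ℓ u ≤ ℓ := min_le_right _ _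

theorem offset_cons (e : Fin n × ℕ) (t : List (Fin n × ℕ)) :
    offset adj ℓ (e :: t) = slot adj ℓ e.1 + offset adj ℓ t := by
  simp [offset]

theorem offset_append (s t : List (Fin n × ℕ)) :
    offset adj ℓ (s ++ t) = offset adj ℓ s + offset adj ℓ t := by
  simp [offset]

/-- Each vertex contributes at most one field, of at most its degree many bits. This is the space
bound for the stack of positions. -/
theorem offset_le_totalDegree {st : List (Fin n × ℕ)} (h : (st.map Prod.fst).Nodup) :
    offset adj ℓ st ≤ totalDegree adj := by
  have h₁ : offset adj ℓ st = ∑ u ∈ (st.map Prod.fst).toFinset, slot adj ℓ u := by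
    rw [List.sum_toFinset _ h, offset, List.map_map]
    rfl
  rw [h₁]
  refine (Finset.sum_le_sum_of_subset (Finset.subset_univ _)).trans ?_
  exact Finset.sum_le_sum fun u _ => min_le_left _ _

theorem length_le_totalDegree (u : Fin n) : (adj u).length ≤ totalDegree adj :=
  Finset.single_le_sum (f := fun u => (adj u).length) (fun _ _ => Nat.zero_le _)
    (Finset.mem_univ u)

theorem length_lt_of_nodup {v : Fin n} {st : List (Fin n × ℕ)}
    (h : (v :: st.map Prod.fst).Nodup) : st.length < n := by
  have := h.length_le_card
  simpa using this

/-- A list of length at most `ℓ` gets as many bits as it has entries, which is more than enough; a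
longer one gets `ℓ` bits, and `2 ^ ℓ` exceeds every degree. -/
theorem Sized.lt_two_pow_slot {w : ℕ} {inp : ℕ → ℕ} (hs : Sized adj ℓ w inp) {u : Fin n} {j : ℕ}
    (hj : j < (adj u).length) : j < 2 ^ slot adj ℓ u := by
  have h₁ := length_le_totalDegree (adj := adj) u
  have h₂ := hs.total_lt
  unfold slot
  rcases le_total (adj u).length ℓ with h | h
  · rw [min_eq_left h]
    exact hj.trans Nat.lt_two_pow_self
  · rw [min_eq_right h]
    omega

theorem mod_mul_add_le (x : ℕ) (h : 0 < ℓ) : x % ℓ * ℓ + ℓ ≤ ℓ * ℓ := by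
  have := Nat.mod_lt x h
  nlinarith

theorem mod_mul_disjoint {x y : ℕ} (h : x % ℓ ≠ y % ℓ) :
    x % ℓ * ℓ + ℓ ≤ y % ℓ * ℓ ∨ y % ℓ * ℓ + ℓ ≤ x % ℓ * ℓ := by
  rcases lt_or_gt_of_ne h with h | h
  · left; nlinarith
  · right; nlinarith

/-- Levels less than `ℓ` apart have different places in the circular buffer. -/
theorem mod_ne_of_lt {x y : ℕ} (h₁ : x < y) (h₂ : y < x + ℓ) : x % ℓ ≠ y % ℓ := by
  intro h
  have h₃ := (Nat.modEq_iff_dvd' h₁.le).1 h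
  have := Nat.le_of_dvd (by omega) h₃
  omega

/-- Checkpoint addresses advance by two bits per level, so levels at distance at least `ℓ` leave
room for disjoint records of `2ℓ` bits. -/
theorem add_le_of_mod_eq_zero {x y : ℕ} (hx : x % ℓ = 0) (hy : y % ℓ = 0) (h : x < y) :
    x + ℓ ≤ y := by
  by_contra h'
  exact mod_ne_of_lt h (not_le.1 h') (hx.trans hy.symm)

/-- The head of the stack is the parent, so the successor of `e` on the path is the last element of
`pre`, or `v` itself if `pre` is empty. -/
theorem IsPath.tail {v : Fin n} {pre t : List (Fin n × ℕ)} {e : Fin n × ℕ}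
    (h : IsPath adj v (pre ++ e :: t)) :
    (adj e.1)[e.2]? = some (((v :: pre.map Prod.fst).getLast (by simp))) ∧ IsPath adj e.1 t := by
  induction pre generalizing v with
  | nil => exact h
  | cons a pre ih =>
    have := ih h.2
    simpa using this

/-! ## Correctness of the parts -/

variable {w N : ℕ} {inp : ℕ → ℕ}

theorem wp_fieldLength {Q : BState → Prop} {A : BState}
    (h : ∀ t, t ≤ A.time + 5 → Q { A with
      reg := Function.update A.reg .len (min (A.reg .deg) (A.reg .ell)), time := t }) :
    fieldLength.wp w inp N Q A := by
  by_cases hd : A.reg .ell < A.reg .deg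
  · simpa [fieldLength, hd, hd.le] using h (A.time + 5) le_rfl
  · simpa [fieldLength, hd, not_lt.1 hd] using h (A.time + 3) (by omega)

/-- The depth has just grown by one, so the window is too long by at most one level and a single
increment of `lo` suffices. -/
theorem wp_slide {Q : BState → Prop} {A : BState} (hw : A.reg .lo + A.reg .ell + 1 < 2 ^ w)
    (hle : A.reg .dep ≤ A.reg .lo + A.reg .ell + 1) (he : 0 < A.reg .ell)
    (h : ∀ t x, t ≤ A.time + 9 → Q { A with
      reg := Function.update (Function.update A.reg .lvl x) .lo
        (max (A.reg .lo) (A.reg .dep - A.reg .ell)), time := t }) :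
    slide.wp w inp N Q A := by
  by_cases hd : A.reg .lo + A.reg .ell < A.reg .dep
  · have := h (A.time + 9) (A.reg .lo + A.reg .ell) le_rfl
    rw [show max (A.reg .lo) (A.reg .dep - A.reg .ell) = A.reg .lo + 1 by omega] at this
    simpa [slide, hd, show A.reg .lo + A.reg .ell < 2 ^ w by omega,
      show A.reg .lo + 1 < 2 ^ w by omega, show 1 < 2 ^ w by omega] using this
  · have := h (A.time + 5) (A.reg .lo + A.reg .ell) (by omega)
    rw [show max (A.reg .lo) (A.reg .dep - A.reg .ell) = A.reg .lo by omega] at this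
    have e : Function.update (Function.update A.reg Var.lvl (A.reg .lo + A.reg .ell)) Var.lo
        (A.reg .lo) = Function.update A.reg Var.lvl (A.reg .lo + A.reg .ell) := by
      rw [Function.update_eq_self_iff]
      simp
    rw [e] at this
    simpa [slide, hd, show A.reg .lo + A.reg .ell < 2 ^ w by omega] using this

end
end WordRAM

/-! ### Checkpoints and descending -/

namespace WordRAM
section
variable {n : ℕ} {adj : Fin n → List (Fin n)} {ℓ w N : ℕ} {inp : ℕ → ℕ}

theorem Sized.two_lt (hs : Sized adj ℓ w inp) : 2 < 2 ^ w := by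
  have h₁ := hs.ell_pos
  have h₂ := hs.ell_lt
  calc 2 < 2 ^ 2 := by norm_num
    _ ≤ 2 ^ w := Nat.pow_le_pow_right (by norm_num) (by omega)

theorem wp_checkpoint {Q : BState → Prop} {A : BState} (hℓ : A.reg .ell < w)
    (hN : A.reg .ck + 2 * A.reg .dep + A.reg .ell ≤ N) (hNw : N + 1 < 2 ^ w) (hw : 2 < 2 ^ w)
    (hz : A.reg .zero = 0)
    (hv : A.reg .cur < 2 ^ A.reg .ell) (ho : A.reg .top < 2 ^ A.reg .ell)
    (h : ∀ t x M, t ≤ A.time + 100 →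
      (A.reg .dep % A.reg .ell = 0 →
        readBits M (A.reg .ck + 2 * A.reg .dep) (A.reg .ell) = A.reg .cur ∧
        readBits M (A.reg .ck + 2 * A.reg .dep + A.reg .ell) (A.reg .ell) = A.reg .top) →
      (∀ q, (A.reg .dep % A.reg .ell = 0 →
          q < A.reg .ck + 2 * A.reg .dep ∨ A.reg .ck + 2 * A.reg .dep + 2 * A.reg .ell ≤ q) →
        M q = A.mem q) →
      Q { A with reg := Function.update A.reg .lvl x, mem := M, time := t }) :
    checkpoint.wp w inp N Q A := by
  by_cases hd : A.reg .dep % A.reg .ell = 0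
  -- The computation and test of the residue take `5` steps, the two writes `29` and `31`.
  · have := h (A.time + 65) (A.reg .dep % A.reg .ell)
      (writeBits (writeBits A.mem (A.reg .ck + 2 * A.reg .dep) (A.reg .ell) (A.reg .cur))
        (A.reg .ck + 2 * A.reg .dep + A.reg .ell) (A.reg .ell) (A.reg .top)) (by omega)
      (fun _ => ⟨by
        rw [readBits_writeBits_of_disjoint (by omega), readBits_writeBits_self hv],
        readBits_writeBits_self ho⟩)
      (fun q hq => by
        have := hq hd
        rw [writeBits_of_outside (by omega), writeBits_of_outside (by omega)])
    rw [hd] at this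
    simp only [checkpoint, Cmd.wp, Expr.fits_mod, Expr.fits_var, Expr.val_mod, Expr.val_var,
      Cond.Holds, Function.update_self, hd, hz, BState.tick, Expr.fits_add, Expr.fits_mul,
      Expr.fits_ofNat, Expr.val_add, Expr.val_mul, Expr.val_ofNat, Function.update_of_ne, ne_eq,
      reduceCtorEq, not_false_eq_true, true_and, and_true, not_true_eq_false, forall_const,
      false_implies]
    refine ⟨by omega, by omega, hℓ, hv, by omega, hN, hℓ, ho, ?_⟩
    simpa [add_assoc] using this
  · have := h (A.time + 5) (A.reg .dep % A.reg .ell) A.mem (by omega)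
      (fun h' => absurd h' hd) (fun _ _ => rfl)
    simpa [checkpoint, hd, hz] using this

/-- Only the colours lie below address `n`, so colouring a vertex leaves the stack intact. -/
theorem StackMem.congr {M M' : ℕ → Bool} {lo hi : ℕ} {st : List (Fin n × ℕ)}
    (h : StackMem adj ℓ M lo hi st) (hM : ∀ q, n ≤ q → M' q = M q) :
    StackMem adj ℓ M' lo hi st where
  pos pre e t he := (readBits_congr fun i _ => hM _ (by unfold jsBase ckBase; omega)).trans
    (h.pos pre e t he)
  buf pre e t he h₁ h₂ := (readBits_congr fun i _ => hM _ (by omega)).trans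
    (h.buf pre e t he h₁ h₂)
  vertex pre e t he h₁ := (readBits_congr fun i _ => hM _ (by unfold ckBase; omega)).trans
    (h.vertex pre e t he h₁)
  offset pre e t he h₁ := (readBits_congr fun i _ => hM _ (by unfold ckBase; omega)).trans
    (h.offset pre e t he h₁)

/-- Popping needs no write: what is stored for a level does not depend on the levels above it. -/
theorem StackMem.tail {M : ℕ → Bool} {lo hi hi' : ℕ} {e : Fin n × ℕ} {st : List (Fin n × ℕ)}
    (h : StackMem adj ℓ M lo hi (e :: st)) (hhi : hi' ≤ hi) : StackMem adj ℓ M lo hi' st where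
  pos pre e' t he := h.pos (e :: pre) e' t (by rw [he]; rfl)
  buf pre e' t he h₁ h₂ := h.buf (e :: pre) e' t (by rw [he]; rfl) h₁ (by omega)
  vertex pre e' t he h₁ := h.vertex (e :: pre) e' t (by rw [he]; rfl) h₁
  offset pre e' t he h₁ := h.offset (e :: pre) e' t (by rw [he]; rfl) h₁

/-- The effect of `descend` on the memory. -/
theorem StackMem.push (hs : Sized adj ℓ w inp) {M M₁ : ℕ → Bool} {lo j : ℕ} {v : Fin n}
    {st : List (Fin n × ℕ)} (h : StackMem adj ℓ M lo st.length st)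
    (hn : st.length < n) (hj : j < (adj v).length)
    (hck : st.length % ℓ = 0 →
      readBits M₁ (ckBase n ℓ + 2 * st.length) ℓ = v ∧
      readBits M₁ (ckBase n ℓ + 2 * st.length + ℓ) ℓ = WordRAM.offset adj ℓ st)
    (hM : ∀ q, (st.length % ℓ = 0 →
        q < ckBase n ℓ + 2 * st.length ∨ ckBase n ℓ + 2 * st.length + 2 * ℓ ≤ q) → M₁ q = M q) :
    StackMem adj ℓ (writeBits (writeBits M₁ (n + st.length % ℓ * ℓ) ℓ v)
        (jsBase n ℓ + WordRAM.offset adj ℓ st) (slot adj ℓ v) j)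
      (max lo (st.length + 1 - ℓ)) (st.length + 1) ((v, j) :: st) := by
  have hℓ := hs.ell_pos
  have hv : (v : ℕ) < 2 ^ ℓ := by have := hs.total_lt; omega
  have hb := mod_mul_add_le st.length hℓ
  have hjs : jsBase n ℓ = ckBase n ℓ + (2 * n + 2 * ℓ) := rfl
  have hcb : ckBase n ℓ = n + ℓ * ℓ := rfl
  constructor
  · rintro (_ | ⟨a, pre⟩) e t he
    · obtain ⟨rfl, rfl⟩ := List.cons.inj he
      exact readBits_writeBits_self (hs.lt_two_pow_slot hj)
    · obtain ⟨rfl, he'⟩ := List.cons.inj he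
      change st = pre ++ e :: t at he'
      have ho : WordRAM.offset adj ℓ t + slot adj ℓ e.1 ≤ WordRAM.offset adj ℓ st := by
        rw [he', offset_append, offset_cons]
        omega
      rw [readBits_writeBits_of_disjoint (by omega), readBits_writeBits_of_disjoint (by omega),
        ← h.pos pre e t he']
      exact readBits_congr fun i hi => hM _ fun _ => by omega
  · rintro (_ | ⟨a, pre⟩) e t he h₁ h₂
    · obtain ⟨rfl, rfl⟩ := List.cons.inj he
      rw [readBits_writeBits_of_disjoint (by omega)]
      exact readBits_writeBits_self hv
    · obtain ⟨rfl, he'⟩ := List.cons.inj he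
      change st = pre ++ e :: t at he'
      have hlt : t.length < st.length := by
        rw [he']
        simp
        omega
      -- The new lower end `st.length + 1 - ℓ` of the window excludes the level whose place is being
      -- overwritten.
      have hd := mod_mul_disjoint (mod_ne_of_lt (ℓ := ℓ) hlt (by omega))
      have hb' := mod_mul_add_le t.length hℓ
      rw [readBits_writeBits_of_disjoint (by omega), readBits_writeBits_of_disjoint (by omega),
        ← h.buf pre e t he' (by omega) hlt]
      exact readBits_congr fun i hi => hM _ fun _ => by omega
  · rintro (_ | ⟨a, pre⟩) e t he h₁
    · obtain ⟨rfl, rfl⟩ := List.cons.inj he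
      rw [readBits_writeBits_of_disjoint (by omega), readBits_writeBits_of_disjoint (by omega)]
      exact (hck h₁).1
    · obtain ⟨rfl, he'⟩ := List.cons.inj he
      change st = pre ++ e :: t at he'
      have hlt : t.length < st.length := by
        rw [he']
        simp
        omega
      rw [readBits_writeBits_of_disjoint (by omega), readBits_writeBits_of_disjoint (by omega),
        ← h.vertex pre e t he' h₁]
      refine readBits_congr fun i hi => hM _ fun h₂ => ?_
      -- Both levels carry checkpoints, so the older record ends before the new one begins.
      have := add_le_of_mod_eq_zero h₁ h₂ hlt
      omega
  · rintro (_ | ⟨a, pre⟩) e t he h₁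
    · obtain ⟨rfl, rfl⟩ := List.cons.inj he
      rw [readBits_writeBits_of_disjoint (by omega), readBits_writeBits_of_disjoint (by omega)]
      exact (hck h₁).2
    · obtain ⟨rfl, he'⟩ := List.cons.inj he
      change st = pre ++ e :: t at he'
      have hlt : t.length < st.length := by
        rw [he']
        simp
        omega
      rw [readBits_writeBits_of_disjoint (by omega), readBits_writeBits_of_disjoint (by omega),
        ← h.offset pre e t he' h₁]
      refine readBits_congr fun i hi => hM _ fun h₂ => ?_
      have := add_le_of_mod_eq_zero h₁ h₂ hlt
      omega

theorem Ready.push_color {r : ℕ} {S : Finset (Fin n)} {ρ : Var → ℕ} {M : ℕ → Bool}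
    (h : Ready ℓ r S ρ M) (u : Fin n) :
    ∀ x : Fin n, writeBits M u 1 1 x = decide (x ∈ insert u S) := by
  intro x
  by_cases hx : x = u
  · subst hx
    simp [writeBits]
  · have : (x : ℕ) ≠ u := fun h' => hx (Fin.ext h')
    rw [writeBits_of_outside (by omega), h.color]
    simp [hx]

/-- The depth grows by one, while `lo` grows only if the buffer was full, and then by one. Hence the
buffer term of the potential does not increase, and the bound pays for the actual time alone. -/
theorem wp_descend (hs : Sized adj ℓ w inp) (hN : N = jsBase n ℓ + totalDegree adj)
    {Q : BState → Prop} {A : BState} {r j : ℕ} {v u : Fin n} {st : List (Fin n × ℕ)}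
    {S : Finset (Fin n)} (hA : Active adj ℓ r v j st S A.reg A.mem)
    (hdeg : A.reg .deg = (adj v).length) (hnbr : A.reg .nbr = u)
    (huv : (adj v)[j]? = some u) (hu : u ∉ S)
    (h : ∀ B, Active adj ℓ r u 0 ((v, j) :: st) (insert u S) B.reg B.mem →
      B.out = A.out ++ [0, (u : ℕ)] → potential ℓ B ≤ potential ℓ A + 300 → Q B) :
    descend.wp w inp N Q A := by
  have hℓ := hs.ell_pos
  have hlim := hs.limit_lt
  have htot := hs.total_lt
  have hjs : jsBase n ℓ = ckBase n ℓ + (2 * n + 2 * ℓ) := rfl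
  have hcb : ckBase n ℓ = n + ℓ * ℓ := rfl
  have hdn := length_lt_of_nodup hA.nodup
  have hj : j < (adj v).length := (List.getElem?_eq_some_iff.1 huv).1
  have hnd : (u :: ((v, j) :: st).map Prod.fst).Nodup := by
    refine List.nodup_cons.2 ⟨fun hm => hu (hA.discovered u ?_), hA.nodup⟩
    simpa using hm
  have hoff := offset_le_totalDegree (adj := adj) (ℓ := ℓ) (List.nodup_cons.1 hA.nodup).2
  have hoff' := offset_le_totalDegree (adj := adj) (ℓ := ℓ) (st := (v, j) :: st) hA.nodup
  rw [offset_cons] at hoff'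
  have hb := mod_mul_add_le st.length hℓ
  have hle := hA.le_lo
  have hlo := hA.lo_le
  have hslot := slot_le_ell (adj := adj) (ℓ := ℓ) v
  have hw1 : ℓ < w := hs.ell_lt
  unfold descend
  simp only [Cmd.wp]
  refine wp_checkpoint ?_ ?_ (by omega) hs.two_lt hA.zero ?_ ?_ ?_
  · rw [hA.ell]; exact hw1
  · rw [hA.ck, hA.dep, hA.ell]; omega
  · rw [hA.cur, hA.ell]; omega
  · rw [hA.top, hA.ell]; omega
  intro t₁ x₁ M₁ ht₁ hck hM
  rw [hA.dep, hA.ell, hA.ck] at hck hM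
  rw [hA.cur, hA.top] at hck
  have hst := hA.stack.push hs hdn hj hck hM
  simp only [Expr.fits_add, Expr.fits_var, Expr.fits_mul, Expr.fits_mod, Expr.val_add,
    Expr.val_var, Expr.val_mul, Expr.val_mod, Function.update_of_ne, ne_eq, reduceCtorEq,
    not_false_eq_true, hA.num, hA.dep, hA.ell, hA.cur, true_and]
  refine ⟨⟨by omega, by omega⟩, by omega, hw1, by omega, ?_⟩
  refine wp_fieldLength fun t₂ ht₂ => ?_
  have hmin : min (adj v).length ℓ = slot adj ℓ v := rfl
  simp only [Function.update_of_ne, ne_eq, reduceCtorEq, not_false_eq_true, hA.js, hA.top, hdeg,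
    hA.ell, hA.pos, hA.dep, Function.update_self, hmin, Expr.fits_ofNat, Expr.val_ofNat]
  refine ⟨by omega, by omega, by omega, hs.lt_two_pow_slot hj, by omega,
    ⟨by omega, by omega⟩, ?_⟩
  refine wp_slide ?_ ?_ ?_ ?_
  · simp [hA.ell]; omega
  · simp [hA.ell]; omega
  · simp [hA.ell]; omega
  intro t₃ x₃ ht₃
  have h1 : 1 < 2 ^ w := by omega
  simp only [Function.update_of_ne, ne_eq, reduceCtorEq, not_false_eq_true, hnbr, hA.ell,
    Function.update_self]
  refine ⟨h1, h1, by omega, by omega, by norm_num, by omega, by omega, ?_⟩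
  apply h
  · refine ⟨⟨⟨?_, ?_, ?_, ?_, ?_, ?_, ?_⟩, ?_, ?_, ?_, ?_, ?_, ?_, ?_, ?_, ?_, ?_⟩, ?_, ?_⟩
    · simp [hA.num]
    · simp [hA.ell]
    · simp [hA.ck]
    · simp [hA.js]
    · simp [hA.zero]
    · simp [hA.root]
    -- The writes to the stack areas happen at addresses from `n` on and keep the old colours; only
    -- afterwards is `u` coloured.
    · have hr : Ready ℓ r S A.reg (writeBits (writeBits M₁ (n + st.length % ℓ * ℓ) ℓ v)
        (jsBase n ℓ + WordRAM.offset adj ℓ st) (slot adj ℓ v) j) := by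
        refine ⟨hA.num, hA.ell, hA.ck, hA.js, hA.zero, hA.root, fun x => ?_⟩
        rw [writeBits_of_outside (by omega), writeBits_of_outside (by omega),
          hM _ (fun _ => by omega), hA.color]
      exact hr.push_color u
    · simp
    · simp
    · simp; omega
    · simp; omega
    · simp [offset_cons]; omega
    · simp [hA.flag]
    · exact ⟨huv, hA.path⟩
    · exact hnd
    · intro x hx
      rcases List.mem_cons.1 hx with rfl | hx
      · exact Finset.mem_insert_self _ _
      · exact Finset.mem_insert_of_mem (hA.discovered x hx)
    · have := hst.congr (M' := writeBits (writeBits (writeBits M₁ (n + st.length % ℓ * ℓ) ℓ v)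
        (jsBase n ℓ + WordRAM.offset adj ℓ st) (slot adj ℓ v) j) u 1 1)
        (fun q hq => writeBits_of_outside (by omega))
      simpa using this
    · simp
    · simp
  · simp
  · simp only [potential, Function.update_of_ne, Function.update_self, ne_eq, reduceCtorEq,
      not_false_eq_true, hA.dep, Expr.cost_add, Expr.cost_mul, Expr.cost_var, Expr.cost_ofNat,
      Expr.cost_mod, writeTime] at *
    omega

end
end WordRAM

/-! ### Replaying the path, backtracking and single search steps -/

namespace WordRAM
section
variable {n : ℕ} {adj : Fin n → List (Fin n)} {ℓ w N : ℕ} {inp : ℕ → ℕ}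

/-- Rewriting the buffer entry of level `t.length`. -/
theorem StackMem.rebuffer (hs : Sized adj ℓ w inp) {M : ℕ → Bool} {lo : ℕ} {e : Fin n × ℕ}
    {pre t : List (Fin n × ℕ)} (h : StackMem adj ℓ M lo t.length (pre ++ e :: t))
    (hlo : t.length < lo + ℓ) :
    StackMem adj ℓ (writeBits M (n + t.length % ℓ * ℓ) ℓ e.1) lo (t.length + 1)
      (pre ++ e :: t) := by
  have hℓ := hs.ell_pos
  have he : (e.1 : ℕ) < 2 ^ ℓ := by have := hs.total_lt; omega
  have hb := mod_mul_add_le t.length hℓ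
  have hjs : jsBase n ℓ = ckBase n ℓ + (2 * n + 2 * ℓ) := rfl
  have hcb : ckBase n ℓ = n + ℓ * ℓ := rfl
  constructor
  · intro pre' e' t' he'
    rw [readBits_writeBits_of_disjoint (by omega), h.pos pre' e' t' he']
  · intro pre' e' t' he' h₁ h₂
    by_cases hl : t'.length = t.length
    -- Tails of equal length in two decompositions of the same stack coincide, so `e'` is the entry
    -- just written.
    · have := List.append_inj' he' (by simp [hl])
      obtain ⟨rfl, rfl⟩ := List.cons.inj this.2
      exact readBits_writeBits_self he
    · have hd := mod_mul_disjoint (mod_ne_of_lt (ℓ := ℓ) (x := t'.length) (y := t.length)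
        (by omega) (by omega))
      rw [readBits_writeBits_of_disjoint (by omega), h.buf pre' e' t' he' h₁ (by omega)]
  · intro pre' e' t' he' h₁
    rw [readBits_writeBits_of_disjoint (by omega), h.vertex pre' e' t' he' h₁]
  · intro pre' e' t' he' h₁
    rw [readBits_writeBits_of_disjoint (by omega), h.offset pre' e' t' he' h₁]

/-- The registers and the memory when the buffer entries of the levels from `lo` up to the length
of `t` have been restored. -/
structure Replaying (adj : Fin n → List (Fin n)) (ℓ r lo : ℕ) (v : Fin n)
    (pre t : List (Fin n × ℕ)) (S : Finset (Fin n)) (ρ : Var → ℕ) (M : ℕ → Bool) : Prop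
    extends Ready ℓ r S ρ M where
  cur : ρ .cur = v
  dep : ρ .dep = (pre ++ t).length
  lo_eq : ρ .lo = lo
  top : ρ .top = WordRAM.offset adj ℓ (pre ++ t)
  flag : ρ .flag = 1
  lvl : ρ .lvl = t.length
  off : ρ .off = WordRAM.offset adj ℓ t
  nbr : ρ .nbr = (v :: pre.map Prod.fst).getLast (by simp)
  stack : StackMem adj ℓ M lo t.length (pre ++ t)

theorem input_length (hs : Sized adj ℓ w inp) (u : Fin n) : inp (inp u) = (adj u).length :=
  hs.array.length u

theorem input_neighbor (hs : Sized adj ℓ w inp) {u v : Fin n} {j : ℕ}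
    (h : (adj u)[j]? = some v) : inp (inp u + 1 + j) = v ∧ inp u + 1 + j < 2 ^ w := by
  obtain ⟨hj, rfl⟩ := List.getElem?_eq_some_iff.1 h
  have := hs.array.fits u
  exact ⟨hs.array.neighbor u j hj, by omega⟩

/-- Knowing the vertex of a level gives its degree, hence the width of its field, hence the stored
index; by `IsPath` the neighbour at that index is the next vertex of the path. -/
theorem wp_replay (hs : Sized adj ℓ w inp) (hN : N = jsBase n ℓ + totalDegree adj)
    {Q : BState → Prop} {A : BState} {r lo : ℕ} {v : Fin n} {e : Fin n × ℕ}
    {pre t : List (Fin n × ℕ)} {S : Finset (Fin n)} (hpath : IsPath adj v (pre ++ e :: t))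
    (hnd : ((pre ++ e :: t).map Prod.fst).Nodup) (hlo : (pre ++ e :: t).length ≤ lo + ℓ)
    (hn : (pre ++ e :: t).length < n)
    (hA : Replaying adj ℓ r lo v (pre ++ [e]) t S A.reg A.mem)
    (h : ∀ B, Replaying adj ℓ r lo v pre (e :: t) S B.reg B.mem → B.out = A.out →
      B.time ≤ A.time + 80 → Q B) :
    replay.wp w inp N Q A := by
  have hℓ := hs.ell_pos
  have hlim := hs.limit_lt
  have htot := hs.total_lt
  have hjs : jsBase n ℓ = ckBase n ℓ + (2 * n + 2 * ℓ) := rfl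
  have hcb : ckBase n ℓ = n + ℓ * ℓ := rfl
  have hw1 : ℓ < w := hs.ell_lt
  have hb := mod_mul_add_le t.length hℓ
  have hoff := offset_le_totalDegree (adj := adj) (ℓ := ℓ) hnd
  have hslot := slot_le_ell (adj := adj) (ℓ := ℓ) e.1
  rw [offset_append, offset_cons] at hoff
  simp only [List.length_append, List.length_cons] at hlo hn
  have happ : pre ++ [e] ++ t = pre ++ e :: t := by simp
  have hnbr : A.reg .nbr = e.1 := by
    rw [hA.nbr]
    simp
  have hst := hA.stack
  rw [happ] at hst
  have hst' := hst.rebuffer hs (by omega)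
  obtain ⟨hlink, -⟩ := hpath.tail
  obtain ⟨hin, hinw⟩ := input_neighbor hs hlink
  have hpos := hst'.pos pre e t rfl
  have hmin : min (adj e.1).length ℓ = slot adj ℓ e.1 := rfl
  unfold replay
  simp only [Cmd.wp, Expr.fits_add, Expr.fits_var, Expr.fits_mul, Expr.fits_mod, Expr.val_add,
    Expr.val_var, Expr.val_mul, Expr.val_mod, Expr.val_input, Expr.fits_input, hA.num, hA.ell,
    hA.lvl, hnbr, true_and, input_length hs]
  refine ⟨by omega, by omega, hw1, by omega, ?_⟩
  refine wp_fieldLength fun t₂ ht₂ => ?_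
  simp only [Function.update_of_ne, ne_eq, reduceCtorEq, not_false_eq_true, hA.js, hA.off,
    hA.ell, Function.update_self, hmin, hnbr, hA.lvl, hpos, hin, Expr.val_ofNat, Expr.fits_ofNat]
  refine ⟨by omega, by omega, by omega, by omega, by omega, by omega, ?_⟩
  apply h
  · refine ⟨⟨?_, ?_, ?_, ?_, ?_, ?_, ?_⟩, ?_, ?_, ?_, ?_, ?_, ?_, ?_, ?_, ?_⟩
    · simp [hA.num]
    · simp [hA.ell]
    · simp [hA.ck]
    · simp [hA.js]
    · simp [hA.zero]
    · simp [hA.root]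
    · intro x
      exact (writeBits_of_outside (by omega)).trans (hA.color x)
    · simp [hA.cur]
    · simp [hA.dep]
    · simp [hA.lo_eq]
    · simp [hA.top]
    · simp [hA.flag]
    · simp
    · simp [offset_cons]; omega
    · simp
    · exact hst'
  · simp
  · simp at ht₂ ⊢
    omega

/-- Replaying moves away from the root, whereas the list starts at the top of the stack; hence the
induction on `pre` from its right end. Each level costs at most `81` with the loop test, rounded up
to the `100` used in `potential`. -/
theorem wp_replay_loop (hs : Sized adj ℓ w inp) (hN : N = jsBase n ℓ + totalDegree adj)
    {Q : BState → Prop} {A : BState} {r lo : ℕ} {v : Fin n} {st : List (Fin n × ℕ)}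
    {S : Finset (Fin n)} (hpath : IsPath adj v st)
    (hnd : (v :: st.map Prod.fst).Nodup) (hlo : st.length ≤ lo + ℓ)
    (pre t : List (Fin n × ℕ)) (hpre : pre ++ t = st)
    (hA : Replaying adj ℓ r lo v pre t S A.reg A.mem)
    (h : ∀ B, Replaying adj ℓ r lo v [] st S B.reg B.mem → B.out = A.out →
      B.time ≤ A.time + 100 * pre.length + 1 → Q B) :
    LoopWP (.lt .lvl .dep) (replay.wp w inp N) Q A := by
  induction pre using List.reverseRecOn generalizing t A with
  | nil =>
    refine .done ?_ (h _ ?_ rfl ?_)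
    · simp [hA.lvl, hA.dep]
    · rw [List.nil_append] at hpre
      exact hpre ▸ hA
    · simp
  | append_singleton pre e ih =>
    have hpre' : pre ++ e :: t = st := by simpa using hpre
    refine .step (fun B => Replaying adj ℓ r lo v pre (e :: t) S B.reg B.mem ∧ B.out = A.out ∧
      B.time ≤ A.time + 81) ?_ ?_ ?_
    · simp only [Cond.Holds, hA.lvl, hA.dep]
      simp
      omega
    · refine wp_replay hs hN (pre := pre) (e := e) (by rw [hpre']; exact hpath)
        (by rw [hpre']; exact (List.nodup_cons.1 hnd).2) (by rw [hpre']; exact hlo)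
        (by rw [hpre']; exact length_lt_of_nodup hnd) hA fun B hB ho ht => ⟨hB, ho, ?_⟩
      simp at ht
      omega
    · rintro B ⟨hB, ho, ht⟩
      refine ih (e :: t) hpre' hB fun C hC ho' ht' => h C hC (ho'.trans ho) ?_
      simp
      omega

/-- The buffer is empty, so the potential includes `100 * ℓ`. Restoring `dep - x` levels takes time
about `100 * (dep - x)` and lowers the buffer term by exactly this amount; only the constant
overhead remains. -/
theorem wp_restore (hs : Sized adj ℓ w inp) (hN : N = jsBase n ℓ + totalDegree adj)
    {Q : BState → Prop} {A : BState} {r : ℕ} {v : Fin n} {st : List (Fin n × ℕ)}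
    {S : Finset (Fin n)} (hA : OnPath adj ℓ r v st S A.reg A.mem) (hne : st ≠ [])
    (hlo : A.reg .lo = st.length)
    (h : ∀ B, OnPath adj ℓ r v st S B.reg B.mem → B.out = A.out → B.reg .lo < st.length →
      potential ℓ B ≤ potential ℓ A + 60 → Q B) :
    restore.wp w inp N Q A := by
  have hℓ := hs.ell_pos
  have hlim := hs.limit_lt
  have htot := hs.total_lt
  have h2 := hs.two_lt
  have hjs : jsBase n ℓ = ckBase n ℓ + (2 * n + 2 * ℓ) := rfl
  have hcb : ckBase n ℓ = n + ℓ * ℓ := rfl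
  have hw1 : ℓ < w := hs.ell_lt
  have hdn := length_lt_of_nodup hA.nodup
  have hlen : 0 < st.length := List.length_pos_iff.2 hne
  -- The last checkpoint at or below the parent's level `st.length - 1`. This choice restores at
  -- least one level and at most `ℓ`.
  obtain ⟨x, hx⟩ : ∃ x, x = st.length - 1 - (st.length - 1) % ℓ := ⟨_, rfl⟩
  have hmod := Nat.mod_lt (st.length - 1) hℓ
  have hmod' := Nat.mod_le (st.length - 1) ℓ
  have hx0 : x % ℓ = 0 := by
    rw [hx]
    exact Nat.sub_mod_eq_zero_of_mod_eq (by simp)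
  obtain ⟨pre, e, t, hst, htx⟩ : ∃ pre e t, st = pre ++ e :: t ∧ t.length = x := by
    obtain ⟨a, t, hat⟩ : ∃ a t, st.drop (st.length - 1 - x) = a :: t :=
      List.exists_cons_of_length_pos (by simp; omega)
    refine ⟨st.take (st.length - 1 - x), a, t, ?_, ?_⟩
    · rw [← hat, List.take_append_drop]
    · have := congrArg List.length hat
      simp at this
      omega
  have hvert := hA.stack.vertex pre e t hst (by rw [htx]; exact hx0)
  have hoffs := hA.stack.offset pre e t hst (by rw [htx]; exact hx0)
  rw [htx] at hvert hoffs
  unfold restore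
  simp only [Cmd.wp, Expr.fits_add, Expr.fits_var, Expr.fits_mul, Expr.fits_mod, Expr.val_add,
    Expr.val_var, Expr.val_mul, Expr.val_mod, Expr.val_sub, Expr.fits_sub, Expr.fits_ofNat,
    Expr.val_ofNat, hA.dep, hA.ell, true_and, Function.update_of_ne, ne_eq, reduceCtorEq,
    not_false_eq_true, Function.update_self, ← hx, hA.ck, hvert, hoffs]
  refine ⟨by omega, hmod', by omega, by omega, hw1, by omega, by omega, hw1, ?_⟩
  refine wp_replay_loop hs hN (lo := x) hA.path hA.nodup (by omega) (pre ++ [e]) t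
    (by simp [hst]) (r := r) (S := S) ?_ ?_
  · have happ : pre ++ [e] ++ t = st := by simp [hst]
    refine ⟨⟨?_, ?_, ?_, ?_, ?_, ?_, hA.color⟩, ?_, ?_, ?_, ?_, ?_, ?_, ?_, ?_, ?_⟩
    · simp [hA.num]
    · simp [hA.ell]
    · simp [hA.ck]
    · simp [hA.js]
    · simp [hA.zero]
    · simp [hA.root]
    · simp [hA.cur]
    · rw [happ]; simp [hA.dep]
    · simp
    · rw [happ]; simp [hA.top]
    · simp [hA.flag]
    · simp [htx]
    · simp
    · simp
    · rw [happ]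
      -- Initially the restored range of levels is empty, so nothing is claimed about the buffer;
      -- the other parts of the stack do not depend on it.
      exact ⟨hA.stack.pos, fun _ _ _ _ h₁ h₂ => by omega, hA.stack.vertex, hA.stack.offset⟩
  · intro B hB ho ht
    have hpl : pre.length + 1 + x = st.length := by
      rw [hst]
      simp
      omega
    have hBdep : B.reg .dep = st.length := hB.dep
    refine h B ⟨hB.toReady, hB.cur, hBdep, ?_, ?_, hB.top, hB.flag, hA.path, hA.nodup,
      hA.discovered, ?_⟩ ho ?_ ?_
    · rw [hB.lo_eq]; omega
    · rw [hB.lo_eq]; omega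
    · rw [hB.lo_eq]; exact hB.stack
    · rw [hB.lo_eq]; omega
    · simp only [potential, hBdep, hB.lo_eq, hlo, hA.dep]
      simp at ht
      omega

/-- The buffered parent yields the width of the topmost field, without which that field could not be
located. The depth decreases by one, which adds `100` to the potential besides the time spent. -/
theorem wp_ascend (hs : Sized adj ℓ w inp) (hN : N = jsBase n ℓ + totalDegree adj)
    {Q : BState → Prop} {A : BState} {r : ℕ} {v : Fin n} {e : Fin n × ℕ} {st : List (Fin n × ℕ)}
    {S : Finset (Fin n)} (hA : OnPath adj ℓ r v (e :: st) S A.reg A.mem)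
    (hlo : A.reg .lo ≤ st.length)
    (h : ∀ B, Active adj ℓ r e.1 (e.2 + 1) st S B.reg B.mem → B.out = A.out →
      potential ℓ B ≤ potential ℓ A + 200 → Q B) :
    ascend.wp w inp N Q A := by
  have hℓ := hs.ell_pos
  have hlim := hs.limit_lt
  have htot := hs.total_lt
  have h2 := hs.two_lt
  have hjs : jsBase n ℓ = ckBase n ℓ + (2 * n + 2 * ℓ) := rfl
  have hcb : ckBase n ℓ = n + ℓ * ℓ := rfl
  have hw1 : ℓ < w := hs.ell_lt
  have hb := mod_mul_add_le st.length hℓ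
  have hoff := offset_le_totalDegree (adj := adj) (ℓ := ℓ) (List.nodup_cons.1 hA.nodup).2
  rw [offset_cons] at hoff
  have hslot := slot_le_ell (adj := adj) (ℓ := ℓ) e.1
  have hmin : min (adj e.1).length ℓ = slot adj ℓ e.1 := rfl
  have hbuf := hA.stack.buf [] e st rfl hlo (by simp)
  have hpos := hA.stack.pos [] e st rfl
  have hj : e.2 < (adj e.1).length := (List.getElem?_eq_some_iff.1 hA.path.1).1
  have hdeg := length_le_totalDegree (adj := adj) e.1
  have hle := hA.le_lo
  have htop := hA.top
  rw [offset_cons] at htop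
  have hdep := hA.dep
  rw [List.length_cons] at hle hdep
  unfold ascend
  simp only [Cmd.wp, Expr.fits_add, Expr.fits_var, Expr.fits_mul, Expr.fits_mod, Expr.val_add,
    Expr.val_var, Expr.val_mul, Expr.val_mod, Expr.val_sub, Expr.fits_sub, Expr.fits_ofNat,
    Expr.val_ofNat, Expr.val_input, Expr.fits_input, hdep, hA.ell, true_and,
    Function.update_of_ne, ne_eq, reduceCtorEq, Nat.add_sub_cancel, hA.num, hbuf,
    not_false_eq_true, Function.update_self, input_length hs]
  refine ⟨by omega, by omega, by omega, hw1, ?_⟩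
  refine wp_fieldLength fun t₂ ht₂ => ?_
  simp only [Function.update_of_ne, ne_eq, reduceCtorEq, not_false_eq_true, hA.js, htop,
    hA.ell, Function.update_self, hmin, Nat.add_sub_cancel_left, hpos]
  refine ⟨by omega, by omega, by omega, by omega, by omega, ?_⟩
  apply h
  · refine ⟨⟨⟨?_, ?_, ?_, ?_, ?_, ?_, hA.color⟩, ?_, ?_, ?_, ?_, ?_, ?_, hA.path.2, ?_, ?_, ?_⟩,
      ?_, hj⟩
    · simp [hA.num]
    · simp [hA.ell]
    · simp [hA.ck]
    · simp [hA.js]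
    · simp [hA.zero]
    · simp [hA.root]
    · simp
    · simp
    · simpa using hlo
    · simp; omega
    · simp
    · simp [hA.flag]
    · exact (List.nodup_cons.1 hA.nodup).2
    · intro x hx
      exact hA.discovered x (List.mem_cons_of_mem _ hx)
    · simpa using hA.stack.tail (by simp)
    · simp
  · simp
  · simp [potential, hdep] at ht₂ ⊢
    omega

theorem searchStep_scan (hs : Sized adj ℓ w inp) (hN : N = jsBase n ℓ + totalDegree adj)
    {Q : BState → Prop} {A : BState} {r j : ℕ} {v u : Fin n} {st : List (Fin n × ℕ)}
    {S : Finset (Fin n)} (hA : Active adj ℓ r v j st S A.reg A.mem)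
    (huv : (adj v)[j]? = some u) (hu : u ∈ S)
    (h : ∀ B, Active adj ℓ r v (j + 1) st S B.reg B.mem → B.out = A.out →
      potential ℓ B ≤ potential ℓ A + 400 → Q B) :
    searchStep.wp w inp N Q A := by
  have hlim := hs.limit_lt
  have h2 := hs.two_lt
  have hℓ := hs.ell_pos
  have hw1 : ℓ < w := hs.ell_lt
  have hjs : jsBase n ℓ = ckBase n ℓ + (2 * n + 2 * ℓ) := rfl
  have hcb : ckBase n ℓ = n + ℓ * ℓ := rfl
  have hj : j < (adj v).length := (List.getElem?_eq_some_iff.1 huv).1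
  have hdeg := length_le_totalDegree (adj := adj) v
  obtain ⟨hin, hinw⟩ := input_neighbor hs huv
  unfold searchStep
  simp only [Cmd.wp, Expr.fits_add, Expr.fits_var, Expr.val_add, Expr.val_var, Expr.fits_ofNat,
    Expr.val_ofNat, Expr.val_input, Expr.fits_input, hA.cur, hA.pos, true_and, Cond.Holds,
    Function.update_of_ne, ne_eq, reduceCtorEq, BState.tick, hin, hA.zero, readBits_one,
    hA.color, hu, hj, decide_true, Bool.toNat_true, one_ne_zero, IsEmpty.forall_iff,
    not_false_eq_true, Function.update_self, input_length hs, forall_const, not_true_eq_false,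
    and_true]
  refine ⟨by omega, by omega, by omega, by omega, by omega, ?_⟩
  apply h
  · refine ⟨⟨⟨?_, ?_, ?_, ?_, ?_, ?_, hA.color⟩, ?_, ?_, ?_, ?_, ?_, ?_, hA.path, hA.nodup,
      hA.discovered, ?_⟩, ?_, hj⟩
    · simp [hA.num]
    · simp [hA.ell]
    · simp [hA.ck]
    · simp [hA.js]
    · simp [hA.zero]
    · simp [hA.root]
    · simp [hA.cur]
    · simp [hA.dep]
    · simpa using hA.lo_le
    · simpa using hA.le_lo
    · simp [hA.top]
    · simp [hA.flag]
    · simpa using hA.stack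
    · simp
  · simp
  · simp [potential]
    omega

theorem searchStep_descend (hs : Sized adj ℓ w inp) (hN : N = jsBase n ℓ + totalDegree adj)
    {Q : BState → Prop} {A : BState} {r j : ℕ} {v u : Fin n} {st : List (Fin n × ℕ)}
    {S : Finset (Fin n)} (hA : Active adj ℓ r v j st S A.reg A.mem)
    (huv : (adj v)[j]? = some u) (hu : u ∉ S)
    (h : ∀ B, Active adj ℓ r u 0 ((v, j) :: st) (insert u S) B.reg B.mem →
      B.out = A.out ++ [0, (u : ℕ)] → potential ℓ B ≤ potential ℓ A + 400 → Q B) :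
    searchStep.wp w inp N Q A := by
  have hlim := hs.limit_lt
  have h2 := hs.two_lt
  have hℓ := hs.ell_pos
  have hw1 : ℓ < w := hs.ell_lt
  have hjs : jsBase n ℓ = ckBase n ℓ + (2 * n + 2 * ℓ) := rfl
  have hcb : ckBase n ℓ = n + ℓ * ℓ := rfl
  have hj : j < (adj v).length := (List.getElem?_eq_some_iff.1 huv).1
  obtain ⟨hin, hinw⟩ := input_neighbor hs huv
  unfold searchStep
  simp only [Cmd.wp, Expr.fits_add, Expr.fits_var, Expr.val_add, Expr.val_var, Expr.fits_ofNat,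
    Expr.val_ofNat, Expr.val_input, Expr.fits_input, hA.cur, hA.pos, true_and, Cond.Holds,
    Function.update_of_ne, ne_eq, reduceCtorEq, BState.tick, hin, hA.zero, readBits_one,
    hA.color, hu, hj, decide_false, Bool.toNat_false, IsEmpty.forall_iff,
    not_false_eq_true, Function.update_self, input_length hs, forall_const, not_true_eq_false,
    and_true]
  refine ⟨by omega, by omega, by omega, by omega, ?_⟩
  refine wp_descend hs hN (r := r) (v := v) (j := j) (st := st) (S := S) (u := u) ?_ ?_ ?_ huv hu
    fun B hB ho ht => h B hB ?_ ?_
  · refine ⟨⟨⟨?_, ?_, ?_, ?_, ?_, ?_, hA.color⟩, ?_, ?_, ?_, ?_, ?_, ?_, hA.path, hA.nodup,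
      hA.discovered, ?_⟩, ?_, hA.pos_le⟩
    · simp [hA.num]
    · simp [hA.ell]
    · simp [hA.ck]
    · simp [hA.js]
    · simp [hA.zero]
    · simp [hA.root]
    · simp [hA.cur]
    · simp [hA.dep]
    · simpa using hA.lo_le
    · simpa using hA.le_lo
    · simp [hA.top]
    · simp [hA.flag]
    · simpa using hA.stack
    · simp [hA.pos]
  · simp
  · simp
  · simpa using ho
  · refine ht.trans ?_
    simp [potential]
    omega

/-- Every search step begins by overwriting `deg`, a register on which the invariant does not
depend. -/
theorem OnPath.of_eqOn {r : ℕ} {v : Fin n} {st : List (Fin n × ℕ)} {S : Finset (Fin n)}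
    {ρ ρ' : Var → ℕ} {M : ℕ → Bool} (h : OnPath adj ℓ r v st S ρ M)
    (hρ : ∀ x, x ≠ .deg → ρ' x = ρ x) : OnPath adj ℓ r v st S ρ' M := by
  refine ⟨⟨?_, ?_, ?_, ?_, ?_, ?_, h.color⟩, ?_, ?_, ?_, ?_, ?_, ?_, h.path, h.nodup,
    h.discovered, ?_⟩ <;> rw [hρ _ (by simp)]
  exacts [h.num, h.ell, h.ck, h.js, h.zero, h.root, h.cur, h.dep, h.lo_le, h.le_lo, h.top, h.flag,
    h.stack]

/-- If `dep = lo`, no ancestor is buffered and `restore` has to come first; in both cases the parent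
is buffered when `ascend` starts. -/
theorem searchStep_ascend (hs : Sized adj ℓ w inp) (hN : N = jsBase n ℓ + totalDegree adj)
    {Q : BState → Prop} {A : BState} {r : ℕ} {v : Fin n} {e : Fin n × ℕ} {st : List (Fin n × ℕ)}
    {S : Finset (Fin n)} (hA : Active adj ℓ r v (adj v).length (e :: st) S A.reg A.mem)
    (h : ∀ B, Active adj ℓ r e.1 (e.2 + 1) st S B.reg B.mem → B.out = A.out ++ [1, (v : ℕ)] →
      potential ℓ B ≤ potential ℓ A + 400 → Q B) :
    searchStep.wp w inp N Q A := by
  have h2 := hs.two_lt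
  unfold searchStep
  simp only [Cmd.wp, Expr.fits_var, Expr.val_var, Expr.fits_ofNat,
    Expr.val_ofNat, Expr.val_input, Expr.fits_input, hA.cur, hA.pos, true_and, Cond.Holds,
    Function.update_of_ne, ne_eq, reduceCtorEq, BState.tick, hA.zero,
    IsEmpty.forall_iff, not_false_eq_true, Function.update_self, input_length hs, forall_const,
    lt_irrefl, hA.dep, List.length_cons, Nat.add_eq_zero_iff, one_ne_zero, and_false]
  have hlo := hA.lo_le
  rw [List.length_cons] at hlo
  refine ⟨by omega, fun heq => ?_, fun hne => ?_⟩
  · refine wp_restore hs hN (r := r) (v := v) (st := e :: st) (S := S)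
      (hA.toOnPath.of_eqOn fun x hx => Function.update_of_ne hx _ _) (by simp) (by simp [heq])
      fun B hB ho hlt ht => ?_
    refine wp_ascend hs hN hB (by simpa [Nat.lt_succ_iff] using hlt) fun C hC ho' ht' =>
      h C hC ?_ ?_
    · simpa [ho] using ho'
    · refine ht'.trans ((Nat.add_le_add_right ht _).trans ?_)
      simp [potential]
      omega
  · refine wp_ascend hs hN (r := r) (v := v) (e := e) (st := st) (S := S)
      (hA.toOnPath.of_eqOn fun x hx => Function.update_of_ne hx _ _) ?_ fun C hC ho' ht' =>
      h C hC ?_ ?_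
    · simp
      omega
    · simpa using ho'
    · refine ht'.trans ?_
      simp [potential]
      omega

theorem searchStep_last (hs : Sized adj ℓ w inp)
    {Q : BState → Prop} {A : BState} {r : ℕ} {v : Fin n}
    {S : Finset (Fin n)} (hA : Active adj ℓ r v (adj v).length [] S A.reg A.mem)
    (h : ∀ B, Ready ℓ r S B.reg B.mem → B.reg .dep = 0 → B.reg .lo = 0 → B.reg .top = 0 →
      B.reg .flag = 0 → B.out = A.out ++ [1, (v : ℕ)] →
      potential ℓ B ≤ potential ℓ A + 400 → Q B) :
    searchStep.wp w inp N Q A := by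
  have h2 := hs.two_lt
  unfold searchStep
  simp only [Cmd.wp, Expr.fits_var, Expr.val_var, Expr.fits_ofNat,
    Expr.val_ofNat, Expr.val_input, Expr.fits_input, hA.cur, hA.pos, true_and, Cond.Holds,
    Function.update_of_ne, ne_eq, reduceCtorEq, BState.tick, hA.zero,
    IsEmpty.forall_iff, not_false_eq_true, Function.update_self, input_length hs, forall_const,
    lt_irrefl, hA.dep, List.length_nil, not_true_eq_false, and_true]
  refine ⟨by omega, by omega, ?_⟩
  -- At depth `0` the invariant forces `lo = 0`, so the next search starts with an empty window
  -- again.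
  have hlo := hA.lo_le
  rw [List.length_nil] at hlo
  apply h
  · refine ⟨?_, ?_, ?_, ?_, ?_, ?_, hA.color⟩
    · simp [hA.num]
    · simp [hA.ell]
    · simp [hA.ck]
    · simp [hA.js]
    · simp [hA.zero]
    · simp [hA.root]
  · simp [hA.dep]
  · simp
    omega
  · simpa [offset] using hA.top
  · simp
  · simp
  · simp [potential]
    omega

end
end WordRAM

/-! ### Existence of the traversal -/

theorem DFSScan.subset {V : Type} [DecidableEq V] {adj : V → List V} {vs : List V}
    {S S' : Finset V} {es : List (DFSEvent V)} (h : DFSScan adj vs S es S') : S ⊆ S' := by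
  induction h with
  | nil => exact subset_rfl
  | skip _ _ ih => exact ih
  | visit _ _ _ ih₁ ih₂ => exact ((Finset.subset_insert _ _).trans ih₁).trans ih₂

/-- Every recursive visit discovers a new vertex. The outer induction is on the number of
undiscovered vertices, the inner one on the list being scanned, for all larger sets of discovered
vertices. -/
theorem DFSScan.exists {V : Type} [DecidableEq V] [Fintype V] (adj : V → List V) (S : Finset V)
    (vs : List V) : ∃ es S', DFSScan adj vs S es S' := by
  induction hk : Fintype.card V - S.card using Nat.strong_induction_on generalizing S vs with
  | _ k ih =>
    have main : ∀ (vs : List V) (S' : Finset V), S ⊆ S' →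
        ∃ es S'', DFSScan adj vs S' es S'' := by
      intro vs
      induction vs with
      | nil => exact fun S' _ => ⟨[], S', .nil S'⟩
      | cons v vs ihvs =>
        intro S' hS
        by_cases hv : v ∈ S'
        · obtain ⟨es, S'', h⟩ := ihvs S' hS
          exact ⟨es, S'', .skip hv h⟩
        · have h₁ : (insert v S').card = S'.card + 1 := Finset.card_insert_of_notMem hv
          have h₂ := Finset.card_le_univ (insert v S')
          have h₃ := Finset.card_le_card hS
          obtain ⟨es₁, S₁, h⟩ := ih _ (by omega) (insert v S') (adj v) rfl
          obtain ⟨es₂, S₂, h'⟩ :=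
            ihvs S₁ ((hS.trans (Finset.subset_insert _ _)).trans h.subset)
          exact ⟨_, S₂, .visit hv h h'⟩
    exact main vs S subset_rfl

/-! ### The search loops and their amortized cost -/

namespace WordRAM
section
variable {n : ℕ} {adj : Fin n → List (Fin n)} {ℓ w N : ℕ} {inp : ℕ → ℕ}

/-- The number of search steps charged to a set of vertices. -/
def weight (adj : Fin n → List (Fin n)) (S : Finset (Fin n)) : ℕ :=
  ∑ u ∈ S, ((adj u).length + 1)

theorem weight_insert {S : Finset (Fin n)} {v : Fin n} (h : v ∉ S) :
    weight adj (insert v S) = (adj v).length + 1 + weight adj S :=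
  Finset.sum_insert h

theorem weight_le (S : Finset (Fin n)) : weight adj S ≤ totalDegree adj + n := by
  refine (Finset.sum_le_sum_of_subset (Finset.subset_univ S)).trans ?_
  simp [Finset.sum_add_distrib, totalDegree]

/-- The program has one flat loop where the recursion nests, so the lemma is stated with a
continuation: it suffices to treat the loop from the moment when the list of `v` is exhausted but
`v` is not yet finished. The caller then performs the finishing step, `searchStep_ascend` inside the
recursion and `searchStep_last` at a root. A step costs `400`, plus `1` for the loop test. Each
entry of `vs` is charged one step, which is the descent if the entry is visited; a newly discovered
vertex is charged for its own entries and its finishing step, which is `weight`. -/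
theorem searchLoop_scan (hs : Sized adj ℓ w inp) (hN : N = jsBase n ℓ + totalDegree adj)
    {r : ℕ} {Q : BState → Prop} {vs : List (Fin n)} {S S' : Finset (Fin n)}
    {es : List (DFSEvent (Fin n))} (h : DFSScan adj vs S es S') :
    ∀ (v : Fin n) (j : ℕ) (st : List (Fin n × ℕ)) (A : BState), vs = (adj v).drop j →
      Active adj ℓ r v j st S A.reg A.mem →
      (∀ B, Active adj ℓ r v (adj v).length st S' B.reg B.mem →
        B.out = A.out ++ es.flatMap DFSEvent.encode →
        potential ℓ B + 401 * weight adj S ≤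
          potential ℓ A + 401 * (vs.length + weight adj S') →
        LoopWP (.ne .flag .zero) (searchStep.wp w inp N) Q B) →
      LoopWP (.ne .flag .zero) (searchStep.wp w inp N) Q A := by
  induction h with
  | nil S =>
    intro v j st A hvs hA hQ
    have hj : j = (adj v).length :=
      le_antisymm hA.pos_le (List.drop_eq_nil_iff.1 hvs.symm)
    subst hj
    exact hQ A hA (by simp) (by simp)
  | @skip u vs S S' es hu _ ih =>
    intro v j st A hvs hA hQ
    have hget : (adj v)[j]? = some u := by
      rw [← List.head?_drop, ← hvs]
      rfl
    have hdrop : vs = (adj v).drop (j + 1) := by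
      rw [← List.tail_drop, ← hvs]
      rfl
    refine .step _ (by simp [hA.flag, hA.zero])
      (searchStep_scan hs hN (A := A.tick) hA hget hu fun B hB ho ht => ?_) fun B hB => hB
    refine ih v (j + 1) st B hdrop hB fun C hC ho' ht' => hQ C hC ?_ ?_
    · rw [ho', ho]; rfl
    · simp only [potential, BState.tick, List.length_cons] at *
      omega
  | @visit u vs S S₁ S₂ es₁ es₂ hu h₁ h₂ ih₁ ih₂ =>
    intro v j st A hvs hA hQ
    have hget : (adj v)[j]? = some u := by
      rw [← List.head?_drop, ← hvs]
      rfl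
    have hdrop : vs = (adj v).drop (j + 1) := by
      rw [← List.tail_drop, ← hvs]
      rfl
    refine .step _ (by simp [hA.flag, hA.zero])
      (searchStep_descend hs hN (A := A.tick) hA hget hu fun B hB ho ht => ?_) fun B hB => hB
    refine ih₁ u 0 _ B (by simp) hB fun C hC hoC htC => ?_
    refine .step _ (by simp [hC.flag, hC.zero])
      (searchStep_ascend hs hN (A := C.tick) hC fun D hD hoD htD => ?_) fun B hB => hB
    refine ih₂ v (j + 1) st D hdrop hD fun E hE hoE htE => hQ E hE ?_ ?_
    · rw [hoE, hoD, BState.tick, hoC, ho, BState.tick]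
      simp [DFSEvent.encode]
    · rw [weight_insert hu] at htC
      simp only [potential, BState.tick, List.length_cons] at *
      omega

/-- The registers and the memory between two searches. -/
structure Between (ℓ r : ℕ) (S : Finset (Fin n)) (ρ : Var → ℕ) (M : ℕ → Bool) : Prop
    extends Ready ℓ r S ρ M where
  dep : ρ .dep = 0
  lo : ρ .lo = 0
  top : ρ .top = 0

theorem wp_search (hs : Sized adj ℓ w inp) (hN : N = jsBase n ℓ + totalDegree adj)
    {Q : BState → Prop} {A : BState} {v : Fin n} {S S' : Finset (Fin n)}
    {es : List (DFSEvent (Fin n))} (hA : Between ℓ v S A.reg A.mem) (hv : v ∉ S)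
    (hscan : DFSScan adj (adj v) (insert v S) es S')
    (h : ∀ B, Between ℓ v S' B.reg B.mem →
      B.out = A.out ++ [0, (v : ℕ)] ++ es.flatMap DFSEvent.encode ++ [1, (v : ℕ)] →
      potential ℓ B + 401 * weight adj S ≤ potential ℓ A + 401 * weight adj S' + 500 → Q B) :
    search.wp w inp N Q A := by
  have h2 := hs.two_lt
  have hℓ := hs.ell_pos
  have hw1 : ℓ < w := hs.ell_lt
  have hlim := hs.limit_lt
  have hjs : jsBase n ℓ = ckBase n ℓ + (2 * n + 2 * ℓ) := rfl
  have hcb : ckBase n ℓ = n + ℓ * ℓ := rfl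
  unfold search
  simp only [Cmd.wp, Expr.fits_var, Expr.val_var, Expr.fits_ofNat,
    Expr.val_ofNat, hA.root, true_and]
  refine ⟨by omega, by omega, by omega, by omega, by norm_num, by omega, by omega, by omega, ?_⟩
  refine searchLoop_scan hs hN hscan (r := v) v 0 [] _ rfl ?_ ?_
  · refine ⟨⟨⟨?_, ?_, ?_, ?_, ?_, ?_, hA.push_color v⟩, ?_, ?_, ?_, ?_, ?_, ?_, trivial, ?_, ?_,
      ?_⟩, ?_, ?_⟩
    · simp [hA.num]
    · simp [hA.ell]
    · simp [hA.ck]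
    · simp [hA.js]
    · simp [hA.zero]
    · simp [hA.root]
    · simp
    · simp [hA.dep]
    · simp [hA.lo]
    · simp
    · simp [hA.top, offset]
    · simp
    · simp
    · simp
    · constructor <;> intro pre e t he <;> simp at he
    · simp
    · simp
  · intro B hB ho ht
    refine .step _ (by simp [hB.flag, hB.zero])
      (searchStep_last hs (A := B.tick) hB fun C hC h₁ h₂ h₃ h₄ hoC htC => ?_) fun B hB => hB
    refine .done (by simp [h₄, hC.zero]) (h _ ⟨hC, h₁, h₂, h₃⟩ ?_ ?_)
    · simp only [BState.tick] at hoC ⊢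
      rw [hoC, ho]
      simp
    · rw [weight_insert hv] at ht
      simp [potential] at *
      omega

theorem rootLoop_scan (hs : Sized adj ℓ w inp) (hN : N = jsBase n ℓ + totalDegree adj)
    {Q : BState → Prop} {vs : List (Fin n)} {S S' : Finset (Fin n)}
    {es : List (DFSEvent (Fin n))} (h : DFSScan adj vs S es S') :
    ∀ (r : ℕ) (A : BState), vs = (List.finRange n).drop r → r ≤ n →
      Between ℓ r S A.reg A.mem →
      (∀ B, B.out = A.out ++ es.flatMap DFSEvent.encode →
        potential ℓ B + 401 * weight adj S ≤
          potential ℓ A + 401 * weight adj S' + 600 * vs.length + 1 → Q B) →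
      LoopWP (.lt .root .num) (rootStep.wp w inp N) Q A := by
  have h2 := hs.two_lt
  have hℓ := hs.ell_pos
  have hw1 : ℓ < w := hs.ell_lt
  have hlim := hs.limit_lt
  have hjs : jsBase n ℓ = ckBase n ℓ + (2 * n + 2 * ℓ) := rfl
  have hcb : ckBase n ℓ = n + ℓ * ℓ := rfl
  have next : ∀ {v : Fin n} {vs : List (Fin n)} {r : ℕ}, v :: vs = (List.finRange n).drop r →
      r = v ∧ vs = (List.finRange n).drop (r + 1) := by
    intro v vs r hvs
    have hget : (List.finRange n)[r]? = some v := by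
      rw [← List.head?_drop, ← hvs]
      rfl
    refine ⟨?_, ?_⟩
    · obtain ⟨_, hr⟩ := List.getElem?_eq_some_iff.1 hget
      rw [← hr]
      simp
    · rw [← List.tail_drop, ← hvs]
      rfl
  induction h with
  | nil S =>
    intro r A hvs hr hA hQ
    have hr' : n ≤ r := by simpa using List.drop_eq_nil_iff.1 hvs.symm
    refine .done (by simp [hA.root, hA.num, hr']) (hQ _ (by simp) ?_)
    simp [potential]
    omega
  | @skip v vs S S' es hv _ ih =>
    intro r A hvs hr hA hQ
    obtain ⟨rfl, hdrop⟩ := next hvs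
    refine .step (fun B => Between ℓ (v + 1) S B.reg B.mem ∧ B.out = A.out ∧
      potential ℓ B ≤ potential ℓ A + 100) (by simp [hA.root, hA.num]) ?_ ?_
    · unfold rootStep
      simp only [Cmd.wp, Expr.fits_var, Expr.val_var, Expr.fits_ofNat, Expr.val_ofNat, hA.root,
        true_and, Function.update_of_ne, ne_eq, reduceCtorEq, not_false_eq_true, BState.tick,
        readBits_one, hA.color, hv, Cond.Holds, Function.update_self, hA.zero, decide_true,
        Bool.toNat_true, one_ne_zero, IsEmpty.forall_iff, forall_const, Expr.fits_add,
        Expr.val_add]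
      refine ⟨by omega, by omega, by omega, by omega,
        ⟨⟨?_, ?_, ?_, ?_, ?_, ?_, hA.color⟩, ?_, ?_, ?_⟩, ?_⟩
      · simp [hA.num]
      · simp [hA.ell]
      · simp [hA.ck]
      · simp [hA.js]
      · simp [hA.zero]
      · simp
      · simp [hA.dep]
      · simp [hA.lo]
      · simp [hA.top]
      · simp [potential]
        omega
    · rintro B ⟨hB, ho, ht⟩
      refine ih (v + 1) B hdrop v.2 hB fun C ho' ht' => hQ C ?_ ?_
      · rw [ho', ho]
      · simp only [List.length_cons]
        omega
  | @visit v vs S S₁ S₂ es₁ es₂ hv h₁ h₂ ih₁ ih₂ =>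
    -- This hypothesis is about suffixes of the list of roots; the list of `v` is handled by
    -- `wp_search`, applied to `h₁`.
    clear ih₁
    intro r A hvs hr hA hQ
    obtain ⟨rfl, hdrop⟩ := next hvs
    refine .step (fun B => Between ℓ (v + 1) S₁ B.reg B.mem ∧
      B.out = A.out ++ [0, (v : ℕ)] ++ es₁.flatMap DFSEvent.encode ++ [1, (v : ℕ)] ∧
      potential ℓ B + 401 * weight adj S ≤ potential ℓ A + 401 * weight adj S₁ + 600)
      (by simp [hA.root, hA.num]) ?_ ?_
    · unfold rootStep
      simp only [Cmd.wp, Expr.fits_var, Expr.val_var, Expr.fits_ofNat, Expr.val_ofNat, hA.root,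
        true_and, Function.update_of_ne, ne_eq, reduceCtorEq, not_false_eq_true, BState.tick,
        readBits_one, hA.color, hv, Cond.Holds, Function.update_self, hA.zero, decide_false,
        Bool.toNat_false, not_true_eq_false, IsEmpty.forall_iff, forall_const, Expr.fits_add,
        Expr.val_add, and_true]
      refine ⟨by omega, by omega, by omega, ?_⟩
      refine wp_search hs hN (v := v) (S := S) ?_ hv h₁ fun B hB ho ht => ?_
      · refine ⟨⟨?_, ?_, ?_, ?_, ?_, ?_, hA.color⟩, ?_, ?_, ?_⟩
        · simp [hA.num]
        · simp [hA.ell]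
        · simp [hA.ck]
        · simp [hA.js]
        · simp [hA.zero]
        · simp [hA.root]
        · simp [hA.dep]
        · simp [hA.lo]
        · simp [hA.top]
      refine ⟨by rw [hB.root]; omega, ⟨⟨?_, ?_, ?_, ?_, ?_, ?_, hB.color⟩, ?_, ?_, ?_⟩, ho, ?_⟩
      · simp [hB.num]
      · simp [hB.ell]
      · simp [hB.ck]
      · simp [hB.js]
      · simp [hB.zero]
      · simp [hB.root]
      · simp [hB.dep]
      · simp [hB.lo]
      · simp [hB.top]
      · simp [potential] at ht ⊢
        omega
    · rintro B ⟨hB, ho, ht⟩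
      refine ih₂ (v + 1) B hdrop v.2 hB fun C ho' ht' => hQ C ?_ ?_
      · rw [ho', ho]
        simp [DFSEvent.encode]
      · simp only [List.length_cons]
        omega

/-! ## Initialization -/

theorem sum_degrees_range (harr : IsAdjacencyArray w adj inp) :
    ∑ i ∈ Finset.range n, inp (inp i) = totalDegree adj := by
  rw [← Fin.sum_univ_eq_sum_range (fun i => inp (inp i)), totalDegree]
  exact Finset.sum_congr rfl fun u _ => harr.length u

/-- The registers and the memory when the first `k` vertices have been cleared. -/
structure Clearing (n : ℕ) (inp : ℕ → ℕ) (k : ℕ) (A : BState) : Prop where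
  num : A.reg .num = n
  root : A.reg .root = k
  total : A.reg .total = n + ∑ i ∈ Finset.range k, inp (inp i)
  others : ∀ x, x ≠ .num → x ≠ .root → x ≠ .total → A.reg x = 0
  clear : ∀ q < k, A.mem q = false
  out : A.out = []
  time : A.time ≤ 2 + 50 * k

/-- The memory starts with arbitrary contents and the number of edges is not given, so the colours
must be cleared and the degrees summed. The other fields need no clearing: the stack invariant makes
claims only about levels already pushed. -/
theorem clearLoop (harr : IsAdjacencyArray w adj inp) (hw : 1 < w) (hn : n ≤ N)
    (hlim : n + totalDegree adj + 1 < 2 ^ w) {Q : BState → Prop} {A : BState} {k : ℕ}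
    (hk : k ≤ n) (hA : Clearing n inp k A) (h : ∀ B, Clearing n inp n B → Q B.tick) :
    LoopWP (.lt .root .num) (clearStep.wp w inp N) Q A := by
  induction hd : n - k generalizing k A with
  | zero =>
    obtain rfl : k = n := by omega
    exact .done (by simp [hA.root, hA.num]) (h A hA)
  | succ d ih =>
    refine .step (Clearing n inp (k + 1)) (by simp [hA.root, hA.num]; omega) ?_
      fun B hB => ih (by omega) hB (by omega)
    have hle : ∑ i ∈ Finset.range (k + 1), inp (inp i) ≤ totalDegree adj := by
      rw [← sum_degrees_range harr]
      exact Finset.sum_le_sum_of_subset (Finset.range_mono (by omega))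
    rw [Finset.sum_range_succ] at hle
    unfold clearStep
    simp only [Cmd.wp, Expr.fits_var, Expr.val_var, Expr.fits_ofNat, Expr.val_ofNat, hA.root,
      true_and, Function.update_of_ne, ne_eq, reduceCtorEq, not_false_eq_true, BState.tick,
      Expr.fits_add, Expr.val_add, Expr.fits_input, Expr.val_input, hA.total]
    refine ⟨by omega, by omega, by omega, by omega, by norm_num, by omega, by omega, ?_⟩
    refine ⟨?_, ?_, ?_, ?_, ?_, hA.out, ?_⟩
    · simp [hA.num]
    · simp
    · simp [Finset.sum_range_succ]
      omega
    · intro x h₁ h₂ h₃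
      simp [h₂, h₃, hA.others x h₁ h₂ h₃]
    · intro q hq
      by_cases hqk : q = k
      · subst hqk
        simp [writeBits]
      · exact (writeBits_of_outside (by omega)).trans (hA.clear q (by omega))
    · have := hA.time
      simp
      omega

theorem two_pow_size_le {t : ℕ} (ht : 0 < t) : 2 ^ t.size ≤ 2 * t := by
  have h : 0 < t.size := Nat.size_pos.2 ht
  have h' : 2 ^ (t.size - 1) ≤ t := Nat.lt_size.1 (by omega)
  calc 2 ^ t.size = 2 ^ (t.size - 1 + 1) := by rw [Nat.sub_add_cancel h]
    _ ≤ 2 * t := by rw [pow_succ]; omega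

/-- The registers and the memory when the length of the fields is being computed. -/
structure Measuring (n t k : ℕ) (A : BState) : Prop where
  num : A.reg .num = n
  total : A.reg .total = t
  ell : A.reg .ell = k
  pw : A.reg .pw = 2 ^ k
  others : ∀ x, x ≠ .num → x ≠ .total → x ≠ .ell → x ≠ .pw → A.reg x = 0
  clear : ∀ q < n, A.mem q = false
  out : A.out = []
  time : A.time ≤ 50 * n + 7 + 10 * k

/-- The loop stops at the first power of two above `t`. That power is at most `2 * t`, so the
doubling never overflows. -/
theorem lengthLoop {t : ℕ} (ht : 0 < t) (hlim : 2 * t + 1 < 2 ^ w) {Q : BState → Prop}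
    {A : BState} {k : ℕ} (hk : k ≤ t.size) (hA : Measuring n t k A)
    (h : ∀ B, Measuring n t t.size B → Q B.tick) :
    LoopWP (.le .pw .total) (lengthStep.wp w inp N) Q A := by
  have hsize := two_pow_size_le ht
  induction hd : t.size - k generalizing k A with
  | zero =>
    obtain rfl : k = t.size := by omega
    exact .done (by simp [hA.pw, hA.total, Nat.lt_size_self]) (h A hA)
  | succ d ih =>
    have hlt : 2 ^ k ≤ t := Nat.lt_size.1 (by omega)
    have hk' : k < 2 ^ k := Nat.lt_two_pow_self
    refine .step (Measuring n t (k + 1)) (by simpa [hA.pw, hA.total] using hlt) ?_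
      fun B hB => ih (by omega) hB (by omega)
    unfold lengthStep
    simp only [Cmd.wp, Expr.fits_var, Expr.val_var, Expr.fits_ofNat, Expr.val_ofNat, hA.pw,
      true_and, Function.update_of_ne, ne_eq, reduceCtorEq, not_false_eq_true, BState.tick,
      Expr.fits_add, Expr.val_add, hA.ell]
    refine ⟨by omega, by omega, ?_⟩
    refine ⟨?_, ?_, ?_, ?_, ?_, hA.clear, hA.out, ?_⟩
    · simp [hA.num]
    · simp [hA.total]
    · simp
    · simp [pow_succ]
      omega
    · intro x h₁ h₂ h₃ h₄
      simp [h₃, h₄, hA.others x h₁ h₂ h₃ h₄]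
    · have := hA.time
      simp
      omega

theorem wp_setup (hn : 0 < n) (hs : Sized adj (n + totalDegree adj).size w inp)
    (hN : N = jsBase n (n + totalDegree adj).size + totalDegree adj)
    (hlim : 2 * (n + totalDegree adj) + 1 < 2 ^ w) {Q : BState → Prop} {A : BState}
    (hnum : A.reg .num = n) (hreg : ∀ x, x ≠ .num → A.reg x = 0) (hout : A.out = [])
    (htime : A.time = 0)
    (h : ∀ B, Between (n := n) (n + totalDegree adj).size 0 ∅ B.reg B.mem → B.out = [] →
      B.time ≤ 50 * n + 10 * (n + totalDegree adj).size + 50 → Q B) :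
    setup.wp w inp N Q A := by
  have h2 := hs.two_lt
  have hℓ := hs.ell_pos
  have hw1 := hs.ell_lt
  have hlim' := hs.limit_lt
  set ℓ := (n + totalDegree adj).size with hℓdef
  have hjs : jsBase n ℓ = ckBase n ℓ + (2 * n + 2 * ℓ) := rfl
  have hcb : ckBase n ℓ = n + ℓ * ℓ := rfl
  unfold setup
  simp only [Cmd.wp, Expr.fits_var, Expr.val_var, true_and, hnum]
  refine clearLoop hs.array (by omega) (by omega) (by omega) (k := 0) (Nat.zero_le _) ?_ ?_
  · refine ⟨by simp [hnum], by simp [hreg], by simp, ?_, by simp, hout, by simp [htime]⟩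
    intro x h₁ _ h₃
    simp [h₃, hreg x h₁]
  intro B hB
  have htot := hB.total
  rw [sum_degrees_range hs.array] at htot
  simp only [Expr.fits_ofNat, Expr.val_ofNat, BState.tick]
  refine ⟨by omega, by omega, ?_⟩
  refine lengthLoop (n := n) (t := n + totalDegree adj) (by omega) hlim (k := 0)
    (Nat.zero_le _) ?_ ?_
  · refine ⟨by simp [hB.num], by simp [htot], by simp [hB.others], by simp, ?_, hB.clear, hB.out,
      ?_⟩
    · intro x h₁ h₂ h₃ h₄
      by_cases hx : x = .root
      · subst hx
        simp
      · simp [hx, h₄, hB.others x h₁ hx h₂]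
    · have := hB.time
      simp
      omega
  intro C hC
  simp only [Expr.fits_ofNat, Expr.val_ofNat, Expr.fits_var, Expr.val_var, Expr.fits_add,
    Expr.fits_mul, Expr.val_add, Expr.val_mul, hC.num, hC.ell, ← hℓdef, BState.tick, true_and,
    Function.update_of_ne, ne_eq, reduceCtorEq, not_false_eq_true, Function.update_self]
  refine ⟨by omega, by omega, ?_⟩
  apply h
  · refine ⟨⟨?_, ?_, ?_, ?_, ?_, ?_, ?_⟩, ?_, ?_, ?_⟩
    · simp [hC.num]
    · simp [hC.ell, hℓdef]
    · simp [ckBase]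
    · simp [ckBase, jsBase]
    · simp [hC.others]
    · simp [hC.others]
    · intro u
      simpa using hC.clear u u.2
    · simp [hC.others]
    · simp [hC.others]
    · simp [hC.others]
  · exact hC.out
  · have := hC.time
    simp
    omega

/-! ## The program on adjacency arrays -/

/-- Applied to `ℓ`, this makes the `ℓ²` bits of the buffer linear in the size of the graph. -/
theorem sq_le_two_pow (k : ℕ) : k * k ≤ 2 * 2 ^ k := by
  induction k with
  | zero => norm_num
  | succ k ih =>
    rw [pow_succ]
    rcases Nat.lt_or_ge k 3 with hk | hk
    · interval_cases k <;> norm_num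
    · nlinarith

/-- The inequality `hm` covers directed graphs, where the degrees sum to `m`, and undirected ones,
where they sum to `2 * m`. -/
theorem performsDFS {m : ℕ} (hn : 0 < n) (hm : totalDegree adj ≤ 2 * m)
    (hw : 64 * (n + m + 1) ≤ 2 ^ w) :
    PerformsDFS dfs.code adj w ((dfs.code.regs + 5000) * (n + m))
      ((dfs.code.regs + 5000) * (n + m + w)) := by
  intro inp work harr hwork
  obtain ⟨ℓ, hℓ⟩ : ∃ ℓ, ℓ = (n + totalDegree adj).size := ⟨_, rfl⟩
  have h₁ : n + totalDegree adj < 2 ^ ℓ := hℓ ▸ Nat.lt_size_self _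
  have h₂ : 2 ^ ℓ ≤ 2 * (n + totalDegree adj) := hℓ ▸ two_pow_size_le (by omega)
  have h₃ := sq_le_two_pow ℓ
  have h₄ : ℓ < 2 ^ ℓ := Nat.lt_two_pow_self
  obtain ⟨N, hN⟩ : ∃ N, N = jsBase n ℓ + totalDegree adj := ⟨_, rfl⟩
  -- With `D` the sum of degrees, `ℓ * ℓ` and `2 * ℓ` are each at most `4 * (n + D)`, so `N ≤ 11 * n
  -- + 9 * D`, and `D ≤ 2 * m`.
  have hN' : N ≤ 20 * (n + m) := by
    rw [hN, jsBase, ckBase]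
    omega
  have hs : Sized adj ℓ w inp := by
    refine ⟨harr, ?_, h₁, ?_, by omega⟩
    · rw [hℓ]
      exact Nat.size_pos.2 (by omega)
    · exact (Nat.pow_lt_pow_iff_right (by norm_num : 1 < 2)).1 (by omega)
  have hw0 : 0 < w := by have := hs.ell_lt; omega
  obtain ⟨es, S, hscan⟩ := DFSScan.exists adj ∅ (List.finRange n)
  let A : BState := ⟨fun x => if x = .num then n else 0, bits w work, [], 0⟩
  have hdesc : Describes w N A (initial n w work) := by
    have hww : w < 2 ^ w := Nat.lt_two_pow_self
    refine ⟨⟨fun r => ?_, hwork⟩, rfl, fun x => ?_, rfl, rfl, rfl, Nat.zero_le _⟩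
    · simp only [initial]
      split_ifs <;> omega
    · cases x <;> simp [initial, A, Var.idx]
  have hwp : dfs.wp w inp N (fun B => B.out = es.flatMap DFSEvent.encode ∧
      B.time ≤ 5000 * (n + m)) A := by
    unfold dfs
    simp only [Cmd.wp]
    refine wp_setup hn (hℓ ▸ hs) (hℓ ▸ hN) (by omega) (by simp [A]) (fun x hx => by simp [A, hx])
      rfl rfl fun B hB ho ht => ?_
    rw [← hℓ] at hB ht
    refine rootLoop_scan hs hN hscan 0 B (by simp) (Nat.zero_le _) hB fun C hoC htC => ⟨?_, ?_⟩
    · rw [hoC, ho, List.nil_append]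
    -- The initial potential contains `100 * ℓ` for the empty buffer, which is linear in the size of
    -- the graph as well.
    · have hwt := weight_le (adj := adj) S
      simp only [potential, hB.dep, hB.lo, List.length_finRange] at htC
      omega
  obtain ⟨τ, B, hrun, hB, hBo, hBt⟩ := dfs.code_runs harr.word (by omega) hdesc hwp
  refine ⟨τ, es, hrun, ⟨S, hscan⟩, hB.out.trans hBo, ?_, ?_⟩
  · rw [hB.time]
    nlinarith
  · have hc := hB.cells
    have hdm : w * (N / w) ≤ N := Nat.mul_div_le N w
    -- Rounding to whole words costs two words; together with the registers this is the `O(w)` part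
    -- of the bound.
    calc w * (dfs.code.regs + τ.cells) ≤ w * (dfs.code.regs + (N / w + 2)) := by gcongr
      _ = w * dfs.code.regs + w * (N / w) + 2 * w := by ring
      _ ≤ (dfs.code.regs + 5000) * (n + m + w) := by nlinarith

end

end WordRAM

/-! ### Counting edges, and the theorem -/

theorem ListsNeighbors.card {n : ℕ} {Adj : Fin n → Fin n → Prop} {adj : Fin n → List (Fin n)}
    (h : ListsNeighbors Adj adj) (u : Fin n) : Nat.card {v // Adj u v} = (adj u).length := by
  rw [Nat.subtype_card (adj u).toFinset fun v => by rw [List.mem_toFinset, (h u).2 v],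
    List.toFinset_card_of_nodup (h u).1]

theorem totalDegree_digraph {n : ℕ} {G : Digraph (Fin n)} {adj : Fin n → List (Fin n)}
    (h : ListsNeighbors G.Adj adj) :
    WordRAM.totalDegree adj = Nat.card {e : Fin n × Fin n // G.Adj e.1 e.2} := by
  rw [Nat.card_congr (Equiv.subtypeProdEquivSigmaSubtype fun u v => G.Adj u v), Nat.card_sigma]
  exact Finset.sum_congr rfl fun u _ => (h.card u).symm

theorem totalDegree_simpleGraph {n : ℕ} {G : SimpleGraph (Fin n)} {adj : Fin n → List (Fin n)}
    (h : ListsNeighbors G.Adj adj) : WordRAM.totalDegree adj = 2 * Nat.card G.edgeSet := by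
  classical
  rw [Nat.card_eq_fintype_card, ← SimpleGraph.edgeFinset_card,
    ← G.sum_degrees_eq_twice_card_edges]
  refine Finset.sum_congr rfl fun u _ => ?_
  rw [← h.card u, ← G.card_neighborSet_eq_degree u, ← Nat.card_eq_fintype_card]
  rfl

theorem le_two_pow_of_clog_add_le {x k w : ℕ} (h : Nat.clog 2 x + k ≤ w) : 2 ^ k * x ≤ 2 ^ w :=
  calc 2 ^ k * x ≤ 2 ^ k * 2 ^ Nat.clog 2 x := by
        gcongr
        exact Nat.le_pow_clog (by norm_num) x
    _ = 2 ^ (Nat.clog 2 x + k) := by rw [pow_add, mul_comm]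
    _ ≤ 2 ^ w := Nat.pow_le_pow_right (by norm_num) h

theorem theorem3 :
    ∃ (P : WordRAM.Program) (k C : ℕ),
      (∀ (n : ℕ) (G : Digraph (Fin n)) (adj : Fin n → List (Fin n)) (m w : ℕ),
        0 < n → ListsNeighbors G.Adj adj →
        m = Nat.card {e : Fin n × Fin n // G.Adj e.1 e.2} →
        Nat.clog 2 (n + m + 1) + k ≤ w →
        WordRAM.PerformsDFS P adj w (C * (n + m)) (C * (n + m + w))) ∧
      (∀ (n : ℕ) (G : SimpleGraph (Fin n)) (adj : Fin n → List (Fin n)) (m w : ℕ),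
        0 < n → ListsNeighbors G.Adj adj →
        m = Nat.card G.edgeSet →
        Nat.clog 2 (n + m + 1) + k ≤ w →
        WordRAM.PerformsDFS P adj w (C * (n + m)) (C * (n + m + w))) := by
  -- Six extra bits give the factor `64 = 2 ^ 6` by which `2 ^ w` has to exceed `n + m + 1` in
  -- `performsDFS`.
  refine ⟨WordRAM.dfs.code, 6, WordRAM.dfs.code.regs + 5000, ?_, ?_⟩
  · intro n G adj m w hn hadj hm hw
    have hdeg := totalDegree_digraph hadj
    exact WordRAM.performsDFS hn (by omega) (by simpa using le_two_pow_of_clog_add_le hw)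
  · intro n G adj m w hn hadj hm hw
    have hdeg := totalDegree_simpleGraph hadj
    exact WordRAM.performsDFS hn (by omega) (by simpa using le_two_pow_of_clog_add_le hw)
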